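/- Let $d,k\ge 1$ be integers. For an open set $\Omega\subset\mathbb R^d$, let $H^1_0(\Omega)$ be the closure of $C_c^\infty(\Omega)$ in the $H^1$ norm (functions are extended by zero to $\mathbb R^d$), with $H^1(\mathbb R^d)=H^1_0(\mathbb R^d)$. For $\Omega$ of finite measure let $\lambda_1(\Omega)\le\lambda_2(\Omega)\le\dots$ be the eigenvalues of the Dirichlet Laplacian on $\Omega$ counted with multiplicity, given by $$\lambda_n(\Omega)=\inf_{S_n\subset H^1_0(\Omega)}\ \sup_{u\in S_n\setminus\{0\}}\frac{\int|\nabla u|^2\,dx}{\int u^2\,dx},$$ the infimum being over the $n$-dimensional linear subspaces $S_n$ of $H^1_0(\Omega)$. Suppose that $\Omega$ is a solution of $$\min\Big\{\lambda_1(\Omega)+\dots+\lambda_k(\Omega)\ :\ \Omega\subset\mathbb R^d\text{ open},\ |\Omega|=1\Big\},$$ and let $U=(u_1,\dots,u_k)\in H^1_0(\Omega;\mathbb R^k)$ be a vector of the first $k$ normalized eigenfunctions on $\Omega$, that is, $-\Delta u_i=\lambda_i(\Omega)u_i$ weakly in $\Omega$ and $\int u_iu_j\,dx=\delta_{ij}$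 for $i,j=1,\dots,k$. Set $\Lambda=\frac2d\sum_{i=1}^k\lambda_i(\Omega)$. Then there are constants $K>0$ and $\varepsilon>0$ such that $$\int_{\mathbb R^d}|\nabla U|^2\,dx+\Lambda\big|\{|U|>0\}\big|\le\Big(1+K\|U-\widetilde U\|_{L^1}\Big)\int_{\mathbb R^d}|\nabla\widetilde U|^2\,dx+\Lambda\big|\{|\widetilde U|>0\}\big|$$ for every $\widetilde U\in H^1(\mathbb R^d;\mathbb R^k)$ such that $\|\widetilde U\|_{L^\infty}\le\varepsilon^{-1}$ and $\|U-\widetilde U\|_{L^1}\le\varepsilon$. -/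

import Mathlib

open MeasureTheory Filter Topology
open scoped ENNReal ContDiff

noncomputable section

/-- `ℝⁿ` with the Euclidean norm. -/
abbrev Euc (n : ℕ) : Type := EuclideanSpace ℝ (Fin n)

/-- `φ ∈ C_c^∞(Ω)`: a smooth function on `ℝ^d` whose support is a compact subset of `Ω`. -/
def IsTestFunction {d : ℕ} (Ω : Set (Euc d)) (φ : Euc d → ℝ) : Prop :=
  ContDiff ℝ ∞ φ ∧ HasCompactSupport φ ∧ tsupport φ ⊆ Ω

/-- `g` is the weak gradient of `u` on `ℝ^d` (used for `u` and `g` in `L²`). -/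
def HasWeakGradient {d : ℕ} (u : Euc d → ℝ) (g : Euc d → Euc d) : Prop :=
  ∀ φ : Euc d → ℝ, IsTestFunction Set.univ φ → ∀ v : Euc d,
    ∫ x, u x * fderiv ℝ φ x v = - ∫ x, inner ℝ (g x) v * φ x

/-- `u ∈ H¹₀(Ω)`, the closure of `C_c^∞(Ω)` for the `H¹` norm; functions in `H¹₀(Ω)` are
extended by zero and so live on all of `ℝ^d`. -/
def MemH10 {d : ℕ} (Ω : Set (Euc d)) (u : Euc d → ℝ) : Prop :=
  MemLp u 2 volume ∧
  ∃ g : Euc d → Euc d, MemLp g 2 volume ∧ HasWeakGradient u g ∧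
    ∃ φ : ℕ → Euc d → ℝ, (∀ n, IsTestFunction Ω (φ n)) ∧
      Tendsto (fun n => eLpNorm (fun x => u x - φ n x) 2 volume) atTop (𝓝 0) ∧
      Tendsto (fun n => eLpNorm (fun x => g x - gradient (φ n) x) 2 volume) atTop (𝓝 0)

/-- `U ∈ H¹₀(Ω; ℝ^k)`: every component belongs to `H¹₀(Ω)`. -/
def MemH10Vec {d k : ℕ} (Ω : Set (Euc d)) (U : Euc d → Euc k) : Prop :=
  ∀ i : Fin k, MemH10 Ω (fun x => U x i)

/-- `U ∈ H¹(ℝ^d; ℝ^k)`, where `H¹(ℝ^d) = H¹₀(ℝ^d)`. -/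
def MemH1Vec {d k : ℕ} (U : Euc d → Euc k) : Prop :=
  MemH10Vec Set.univ U

open Classical in
/-- The weak gradient `∇u` (unique up to a null set; `0` if there is none in `L²`). -/
def weakGrad {d : ℕ} (u : Euc d → ℝ) : Euc d → Euc d :=
  if h : ∃ g : Euc d → Euc d, MemLp g 2 volume ∧ HasWeakGradient u g then h.choose else 0

/-- `∫ |∇u|² dx`. -/
def dirichletEnergy {d : ℕ} (u : Euc d → ℝ) : ℝ≥0∞ :=
  ∫⁻ x, ‖weakGrad u x‖ₑ ^ 2

/-- `∫ |∇U|² dx = ∑ i, ∫ |∇u_i|² dx`. -/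
def dirichletEnergyVec {d k : ℕ} (U : Euc d → Euc k) : ℝ≥0∞ :=
  ∑ i : Fin k, dirichletEnergy (fun x => U x i)

/-- The `n`-th eigenvalue `λ_n(Ω)` (`n ≥ 1`, counted with multiplicity) of the Dirichlet Laplacian
on an open set of finite measure: the infimum over the `n`-dimensional subspaces `S` of `H¹₀(Ω)`
of the supremum over `S \ {0}` of the Rayleigh quotient. Subspaces are taken in `L²(ℝ^d)`, that
is, modulo equality almost everywhere. -/
def dirichletEigenvalue {d : ℕ} (Ω : Set (Euc d)) (n : ℕ) : ℝ≥0∞ :=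
  ⨅ (S : Submodule ℝ (Lp ℝ 2 (volume : Measure (Euc d))))
    (_ : Module.finrank ℝ S = n ∧ ∀ u ∈ S, MemH10 Ω u),
    ⨆ (u : Lp ℝ 2 (volume : Measure (Euc d))) (_ : u ∈ S ∧ u ≠ 0),
      dirichletEnergy u / ∫⁻ x, ‖u x‖ₑ ^ 2

/-- `λ_1(Ω) + ⋯ + λ_k(Ω)`. -/
def eigenvalueSum {d : ℕ} (k : ℕ) (Ω : Set (Euc d)) : ℝ≥0∞ :=
  ∑ i : Fin k, dirichletEigenvalue Ω (i + 1)

/-- `Ω` minimizes `λ_1 + ⋯ + λ_k` among the open subsets of `ℝ^d` of measure `1`. -/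
def IsOptimalSet {d : ℕ} (k : ℕ) (Ω : Set (Euc d)) : Prop :=
  IsOpen Ω ∧ volume Ω = 1 ∧
    ∀ Ω' : Set (Euc d), IsOpen Ω' → volume Ω' = 1 → eigenvalueSum k Ω ≤ eigenvalueSum k Ω'

/-- `u ∈ H¹₀(Ω)` is a weak solution of `-Δu = μ u` in `Ω`. -/
def IsWeakEigenfunction {d : ℕ} (Ω : Set (Euc d)) (μ : ℝ) (u : Euc d → ℝ) : Prop :=
  MemH10 Ω u ∧ ∀ φ : Euc d → ℝ, IsTestFunction Ω φ →
    ∫ x, inner ℝ (weakGrad u x) (gradient φ x) = μ * ∫ x, u x * φ x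

/-- `U = (u_1, …, u_k)` is a vector of the first `k` normalized eigenfunctions on `Ω`: `u_i` is an
eigenfunction for `λ_i(Ω)`, and the `u_i` are orthonormal in `L²`. -/
def IsEigenfunctionVector {d k : ℕ} (Ω : Set (Euc d)) (U : Euc d → Euc k) : Prop :=
  (∀ i : Fin k, IsWeakEigenfunction Ω (dirichletEigenvalue Ω (i + 1)).toReal (fun x => U x i)) ∧
  ∀ i j : Fin k, ∫ x, U x i * U x j = if i = j then 1 else 0

/-- `Λ = (2 / d) ∑ i, λ_i(Ω)`. -/
def lagrangeMultiplier {d : ℕ} (k : ℕ) (Ω : Set (Euc d)) : ℝ≥0∞ :=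
  2 / (d : ℝ≥0∞) * eigenvalueSum k Ω

end

/-! Write S for the sum of the first k eigenvalues of Ω. The argument compares S with arbitrary
competitors V that are only nearly orthonormal. If the Gram matrix of k functions in H¹₀(O) is at
least θ·Id, min-max and a trace inequality bound the eigenvalue sum of O by θ⁻¹ ∑ ∫|∇ψᵢ|²
(`eigenvalueSum_le_of_testFunctions`). Dilating O to unit volume and using optimality of Ω gives S ≤
|O|^(2/d) θ⁻¹ ∑ ∫|∇ψᵢ|². The set {|V| > 0} need not be open, so V is replaced by smooth truncations
supported in open sets of almost no larger measure (`MemH10.exists_testFunction_of_pos`). The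
scale-invariant bound thus holds for V itself (`IsOptimalSet.eigenvalueSum_le_of_memH1Vec`). With p
= 2/d, the tangent inequality 1 + p ≤ m^(-p) + p m turns it into S + Λ ≤ θ⁻¹ ∫|∇V|² + Λ|{|V| > 0}|,
and the left side dominates the functional at U. It remains to find θ with θ⁻¹ ≤ 1 + K‖U - V‖₁. If U
is bounded, the Gram matrix differs from the identity by O(‖U - V‖₁). No L∞ estimate for
eigenfunctions is needed: if U were unbounded, a bounded V would stay at L¹ distance at least some c
> 0 from U, and θ = 1/2 would do with K = 1/c (`exists_gram_constants`). -/

section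

/-! ### Test functions -/

namespace IsTestFunction

variable {d : ℕ} {Ω : Set (Euc d)} {φ ψ : Euc d → ℝ}

theorem mono {Ω' : Set (Euc d)} (h : IsTestFunction Ω φ) (hΩ : Ω ⊆ Ω') : IsTestFunction Ω' φ :=
  ⟨h.1, h.2.1, h.2.2.trans hΩ⟩

theorem differentiable (h : IsTestFunction Ω φ) : Differentiable ℝ φ :=
  h.1.differentiable (by simp)

theorem continuous_fderiv (h : IsTestFunction Ω φ) : Continuous (fderiv ℝ φ) :=
  h.1.continuous_fderiv (by simp)

theorem continuous_gradient (h : IsTestFunction Ω φ) : Continuous (gradient φ) :=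
  (InnerProductSpace.toDual ℝ (Euc d)).symm.continuous.comp h.continuous_fderiv

theorem hasCompactSupport_gradient (h : IsTestFunction Ω φ) :
    HasCompactSupport (gradient φ) :=
  (h.2.1.fderiv ℝ).comp_left (g := (InnerProductSpace.toDual ℝ (Euc d)).symm) (map_zero _)

theorem memLp (h : IsTestFunction Ω φ) (p : ℝ≥0∞) : MemLp φ p volume :=
  h.1.continuous.memLp_of_hasCompactSupport h.2.1

theorem memLp_gradient (h : IsTestFunction Ω φ) (p : ℝ≥0∞) : MemLp (gradient φ) p volume :=
  h.continuous_gradient.memLp_of_hasCompactSupport h.hasCompactSupport_gradient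

theorem zero : IsTestFunction Ω (fun _ => (0 : ℝ)) := by
  refine ⟨contDiff_const, ?_, ?_⟩
  · exact HasCompactSupport.zero
  · simp [tsupport]

theorem add (h : IsTestFunction Ω φ) (h' : IsTestFunction Ω ψ) :
    IsTestFunction Ω (fun x => φ x + ψ x) :=
  ⟨h.1.add h'.1, h.2.1.add h'.2.1,
    (tsupport_add φ ψ).trans (Set.union_subset h.2.2 h'.2.2)⟩

theorem const_mul (h : IsTestFunction Ω φ) (c : ℝ) : IsTestFunction Ω (fun x => c * φ x) :=
  ⟨contDiff_const.mul h.1, h.2.1.mul_left,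
    (tsupport_mul_subset_right (f := fun _ => c) (g := φ)).trans h.2.2⟩

theorem sum {ι : Type*} (s : Finset ι) {f : ι → Euc d → ℝ}
    (h : ∀ i, IsTestFunction Ω (f i)) : IsTestFunction Ω (fun x => ∑ i ∈ s, f i x) := by
  classical
  induction s using Finset.induction_on with
  | empty => simpa using zero
  | insert a s ha ih => simpa [Finset.sum_insert ha] using (h a).add ih

theorem comp_smul (h : IsTestFunction Ω φ) {r : ℝ} (hr : r ≠ 0) :
    IsTestFunction ((fun x => r • x) ⁻¹' Ω) (fun x => φ (r • x)) := by
  have e : tsupport (fun x => φ (r • x)) = (fun x => r • x) ⁻¹' tsupport φ := by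
    have := tsupport_comp_eq_preimage φ (Homeomorph.smulOfNeZero r hr : Euc d ≃ₜ Euc d)
    exact this
  refine ⟨h.1.comp (contDiff_const_smul r), ?_, ?_⟩
  · exact h.2.1.comp_homeomorph (Homeomorph.smulOfNeZero r hr)
  · rw [e]; exact Set.preimage_mono h.2.2

end IsTestFunction

variable {d : ℕ}

/-! ### Classical and weak gradients -/

theorem gradient_sum_const_mul {ι : Type*} (s : Finset ι) (c : ι → ℝ) {f : ι → Euc d → ℝ}
    (h : ∀ i, Differentiable ℝ (f i)) (x : Euc d) :
    gradient (fun x => ∑ i ∈ s, c i * f i x) x = ∑ i ∈ s, c i • gradient (f i) x := by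
  refine ext_inner_right ℝ fun v => ?_
  rw [inner_gradient_left, fderiv_fun_sum fun i _ => ((h i x).const_mul (c i)), sum_inner]
  simp [fderiv_const_mul (h _ x), inner_smul_left, inner_gradient_left]

theorem gradient_comp_smul {φ : Euc d → ℝ} (h : Differentiable ℝ φ) (r : ℝ) (x : Euc d) :
    gradient (fun x => φ (r • x)) x = r • gradient φ (r • x) := by
  have h1 : HasFDerivAt (fun x : Euc d => r • x) (r • ContinuousLinearMap.id ℝ (Euc d)) x :=
    (hasFDerivAt_id x).const_smul r
  refine ext_inner_right ℝ fun v => ?_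
  have h2 := ((h (r • x)).hasFDerivAt.comp x h1).fderiv
  rw [inner_gradient_left, inner_smul_left, inner_gradient_left]
  change fderiv ℝ (φ ∘ HSMul.hSMul r) x v = _
  rw [h2]
  simp

theorem gradient_comp_real {φ : Euc d → ℝ} (h : Differentiable ℝ φ) {T : ℝ → ℝ}
    (hT : Differentiable ℝ T) (x : Euc d) :
    gradient (fun x => T (φ x)) x = deriv T (φ x) • gradient φ x := by
  refine HasGradientAt.gradient ?_
  rw [hasGradientAt_iff_hasFDerivAt, map_smul, toDual_gradient]
  exact (hT (φ x)).hasDerivAt.comp_hasFDerivAt x (h x).hasFDerivAt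

theorem IsTestFunction.hasWeakGradient {Ω : Set (Euc d)} {φ : Euc d → ℝ}
    (h : IsTestFunction Ω φ) : HasWeakGradient φ (gradient φ) := by
  intro ψ hψ v
  simp only [inner_gradient_left]
  have c1 : Continuous (fun x => fderiv ℝ φ x v) := h.continuous_fderiv.clm_apply continuous_const
  have c2 : Continuous (fun x => fderiv ℝ ψ x v) := hψ.continuous_fderiv.clm_apply continuous_const
  apply integral_mul_fderiv_eq_neg_fderiv_mul_of_integrable
  · exact (c1.mul hψ.1.continuous).integrable_of_hasCompactSupport hψ.2.1.mul_left
  · exact (h.1.continuous.mul c2).integrable_of_hasCompactSupport h.2.1.mul_right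
  · exact (h.1.continuous.mul hψ.1.continuous).integrable_of_hasCompactSupport h.2.1.mul_right
  · exact fun x _ => h.differentiable x
  · exact fun x _ => hψ.differentiable x

theorem HasWeakGradient.congr {u u' : Euc d → ℝ} {g : Euc d → Euc d} (h : HasWeakGradient u g)
    (e : u =ᵐ[volume] u') : HasWeakGradient u' g := by
  intro φ hφ v
  rw [← h φ hφ v]
  refine integral_congr_ae ?_
  filter_upwards [e] with x hx
  rw [hx]

/-- The fundamental lemma of the calculus of variations, applied to each component. It makes the
arbitrary choice in `weakGrad` harmless. -/
theorem HasWeakGradient.ae_eq {u : Euc d → ℝ} {g g' : Euc d → Euc d} (hg : MemLp g 2 volume)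
    (hg' : MemLp g' 2 volume) (h : HasWeakGradient u g) (h' : HasWeakGradient u g') :
    g =ᵐ[volume] g' := by
  refine ae_eq_of_integral_contDiff_smul_eq (hg.locallyIntegrable (by norm_num))
    (hg'.locallyIntegrable (by norm_num)) ?_
  intro φ hφ hc
  have ht : IsTestFunction Set.univ φ := ⟨hφ, hc, Set.subset_univ _⟩
  have hi : ∀ {G : Euc d → Euc d}, MemLp G 2 volume → Integrable (fun x => φ x • G x) volume :=
    fun hG => memLp_one_iff_integrable.1 (hG.smul (ht.memLp 2))
  refine ext_inner_left ℝ fun v => ?_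
  rw [← integral_inner (hi hg), ← integral_inner (hi hg')]
  have := h φ ht v
  rw [h' φ ht v, neg_inj] at this
  simp only [inner_smul_right]
  calc _ = ∫ x, inner ℝ (g x) v * φ x := by
        congr 1; ext x; rw [real_inner_comm, mul_comm]
    _ = ∫ x, inner ℝ (g' x) v * φ x := this.symm
    _ = _ := by congr 1; ext x; rw [real_inner_comm, mul_comm]

theorem weakGrad_ae_eq {u : Euc d → ℝ} {g : Euc d → Euc d} (hg : MemLp g 2 volume)
    (h : HasWeakGradient u g) : weakGrad u =ᵐ[volume] g := by
  have hex : ∃ g : Euc d → Euc d, MemLp g 2 volume ∧ HasWeakGradient u g := ⟨g, hg, h⟩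
  rw [weakGrad, dif_pos hex]
  exact HasWeakGradient.ae_eq hex.choose_spec.1 hg hex.choose_spec.2 h

theorem lintegral_enorm_sq {α E : Type*} [MeasurableSpace α] {μ : Measure α}
    [NormedAddCommGroup E] (f : α → E) :
    ∫⁻ x, ‖f x‖ₑ ^ 2 ∂μ = eLpNorm f 2 μ ^ 2 := by
  rw [eLpNorm_eq_lintegral_rpow_enorm_toReal (by norm_num) (by norm_num)]
  simp only [ENNReal.toReal_ofNat, one_div, ENNReal.rpow_ofNat]
  rw [← ENNReal.rpow_natCast, ← ENNReal.rpow_mul]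
  simp

theorem dirichletEnergy_eq {u : Euc d → ℝ} {g : Euc d → Euc d} (hg : MemLp g 2 volume)
    (h : HasWeakGradient u g) : dirichletEnergy u = eLpNorm g 2 volume ^ 2 := by
  rw [← lintegral_enorm_sq, dirichletEnergy]
  refine lintegral_congr_ae ?_
  filter_upwards [weakGrad_ae_eq hg h] with x hx
  rw [hx]

theorem IsTestFunction.memH10 {Ω : Set (Euc d)} {φ u : Euc d → ℝ} (h : IsTestFunction Ω φ)
    (e : u =ᵐ[volume] φ) : MemH10 Ω u := by
  refine ⟨(memLp_congr_ae e).2 (h.memLp 2), gradient φ, h.memLp_gradient 2,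
    h.hasWeakGradient.congr e.symm, fun _ => φ, fun _ => h, ?_, ?_⟩
  · have : (fun x => u x - φ x) =ᵐ[volume] 0 := by
      filter_upwards [e] with x hx; simp [hx]
    simp [eLpNorm_congr_ae this]
  · simp

theorem IsTestFunction.dirichletEnergy_eq {Ω : Set (Euc d)} {φ u : Euc d → ℝ}
    (h : IsTestFunction Ω φ) (e : u =ᵐ[volume] φ) :
    dirichletEnergy u = eLpNorm (gradient φ) 2 volume ^ 2 :=
  _root_.dirichletEnergy_eq (h.memLp_gradient 2) (h.hasWeakGradient.congr e.symm)

/-! ### Min-max and the trace inequality -/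

/-- The spectral theorem for the symmetric operator D*D on F. -/
theorem exists_orthonormalBasis_diagonalizing {F H : Type*} [NormedAddCommGroup F]
    [InnerProductSpace ℝ F] [FiniteDimensional ℝ F] [NormedAddCommGroup H]
    [InnerProductSpace ℝ H] [CompleteSpace H] {n : ℕ} (hn : Module.finrank ℝ F = n)
    (D : F →ₗ[ℝ] H) :
    ∃ (e : OrthonormalBasis (Fin n) ℝ F) (μ : Fin n → ℝ), Monotone μ ∧
      ∀ u : F, ‖D u‖ ^ 2 = ∑ i, μ i * inner ℝ (e i) u ^ 2 := by
  let D' : F →L[ℝ] H := LinearMap.toContinuousLinearMap D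
  let T : F →L[ℝ] F := (ContinuousLinearMap.adjoint D') ∘L D'
  have hTi : ∀ u v, inner ℝ (T u) v = inner ℝ (D u) (D v) := fun u v => by
    simp [T, D', ContinuousLinearMap.adjoint_inner_left]
  have hT : (T : F →ₗ[ℝ] F).IsSymmetric := fun u v => by
    have h2 := hTi v u
    rw [real_inner_comm] at h2
    change inner ℝ (T u) v = inner ℝ u (T v)
    rw [hTi, h2, real_inner_comm]
  let b := hT.eigenvectorBasis hn
  -- The spectral theorem lists eigenvalues in decreasing order; reversing the indices makes `μ`
  -- monotone.
  refine ⟨b.reindex Fin.revPerm, fun i => hT.eigenvalues hn (Fin.revPerm i), ?_, fun u => ?_⟩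
  · intro i j hij
    exact hT.eigenvalues_antitone hn (Fin.rev_le_rev.2 hij)
  · have h1 : ‖D u‖ ^ 2 = ∑ i, hT.eigenvalues hn i * inner ℝ (b i) u ^ 2 := by
      rw [← real_inner_self_eq_norm_sq, ← hTi, ← b.sum_inner_mul_inner]
      refine Finset.sum_congr rfl fun i _ => ?_
      have : inner ℝ (T u) (b i) = hT.eigenvalues hn i * inner ℝ (b i) u := by
        have h3 := hT u (b i)
        have h4 := hT.apply_eigenvectorBasis hn i
        change inner ℝ (T u) (b i) = inner ℝ u ((T : F →ₗ[ℝ] F) (b i)) at h3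
        rw [h3]
        change inner ℝ u ((T : F →ₗ[ℝ] F) (hT.eigenvectorBasis hn i)) = _
        rw [h4, inner_smul_right, real_inner_comm]
        rfl
      rw [this]; ring
    rw [h1, ← Equiv.sum_comp Fin.revPerm]
    simp [OrthonormalBasis.reindex_apply]

/-- Expand e_j = ∑ cᵢ fᵢ. The Gram bound gives θ|c|² ≤ 1, while Cauchy–Schwarz in 1 = ∑ cᵢ⟨e_j, fᵢ⟩
gives 1 ≤ |c|² ∑ᵢ ⟨e_j, fᵢ⟩². Hence ∑ᵢ ⟨e_j, fᵢ⟩² ≥ θ for each j; weight by μ_j ≥ 0 and sum. -/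
theorem mul_sum_le_sum_norm_sq_of_diagonalizing {F H ι : Type*} [Fintype ι] [NormedAddCommGroup F]
    [InnerProductSpace ℝ F] [NormedAddCommGroup H]
    [InnerProductSpace ℝ H] (D : F →ₗ[ℝ] H) {κ : Type*} [Fintype κ] (e : OrthonormalBasis κ ℝ F)
    (μ : κ → ℝ) (hD : ∀ u : F, ‖D u‖ ^ 2 = ∑ i, μ i * inner ℝ (e i) u ^ 2)
    (f : ι → F) (hf : Submodule.span ℝ (Set.range f) = ⊤) (θ : ℝ)
    (hθ : ∀ c : ι → ℝ, θ * ∑ i, c i ^ 2 ≤ ‖∑ i, c i • f i‖ ^ 2) :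
    θ * ∑ j, μ j ≤ ∑ i, ‖D (f i)‖ ^ 2 := by
  classical
  have hμ : ∀ j, 0 ≤ μ j := fun j => by
    have := hD (e j)
    rw [Finset.sum_eq_single j] at this
    · simp at this; rw [← this]; positivity
    · intro i _ hij; simp [e.inner_eq_ite, hij]
    · simp
  have key : ∀ j, θ ≤ ∑ i, inner ℝ (e j) (f i) ^ 2 := by
    intro j
    have hmem : e j ∈ Submodule.span ℝ (Set.range f) := by rw [hf]; trivial
    obtain ⟨c, hc⟩ := (Submodule.mem_span_range_iff_exists_fun ℝ).1 hmem
    have h1 := hθ c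
    rw [hc, e.norm_eq_one, one_pow] at h1
    have h2 : ∑ i, c i * inner ℝ (e j) (f i) = 1 := by
      have : inner ℝ (e j) (∑ i, c i • f i) = 1 := by rw [hc]; simp
      simpa [inner_sum, inner_smul_right] using this
    have h3 := Finset.sum_mul_sq_le_sq_mul_sq Finset.univ c (fun i => inner ℝ (e j) (f i))
    rw [h2, one_pow] at h3
    have h4 : 0 ≤ ∑ i, inner ℝ (e j) (f i) ^ 2 := Finset.sum_nonneg fun i _ => sq_nonneg _
    have h5 : 0 ≤ ∑ i, c i ^ 2 := Finset.sum_nonneg fun i _ => sq_nonneg _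
    nlinarith
  calc θ * ∑ j, μ j = ∑ j, μ j * θ := by rw [Finset.mul_sum]; simp [mul_comm]
    _ ≤ ∑ j, μ j * ∑ i, inner ℝ (e j) (f i) ^ 2 :=
        Finset.sum_le_sum fun j _ => mul_le_mul_of_nonneg_left (key j) (hμ j)
    _ = ∑ i, ‖D (f i)‖ ^ 2 := by
        simp only [hD, Finset.mul_sum]
        rw [Finset.sum_comm]

/-- The span of the first i + 1 vectors of `e` is the trial subspace: the coefficients beyond i
vanish there, so the Rayleigh quotient is at most μ_i. -/
theorem dirichletEigenvalue_le {Ω : Set (Euc d)} {F : Submodule ℝ (Lp ℝ 2 (volume : Measure (Euc d)))}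
    {H : Type*} [NormedAddCommGroup H] [InnerProductSpace ℝ H] (D : F →ₗ[ℝ] H)
    (hF : ∀ u : F, MemH10 Ω (u : Lp ℝ 2 (volume : Measure (Euc d))) ∧
      dirichletEnergy (u : Lp ℝ 2 (volume : Measure (Euc d))) = ENNReal.ofReal (‖D u‖ ^ 2))
    {k : ℕ} (e : OrthonormalBasis (Fin k) ℝ F) {μ : Fin k → ℝ} (hμ : Monotone μ)
    (hD : ∀ u : F, ‖D u‖ ^ 2 = ∑ i, μ i * inner ℝ (e i) u ^ 2) (i : Fin k) :
    dirichletEigenvalue Ω (i + 1) ≤ ENNReal.ofReal (μ i) := by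
  have hik : (i : ℕ) + 1 ≤ k := i.2
  let v : Fin (i + 1) → F := fun j => e (Fin.castLE hik j)
  have hv : LinearIndependent ℝ v :=
    e.orthonormal.linearIndependent.comp _ (Fin.castLE_injective hik)
  let S : Submodule ℝ (Lp ℝ 2 (volume : Measure (Euc d))) :=
    (Submodule.span ℝ (Set.range v)).map F.subtype
  have hS : Module.finrank ℝ S = i + 1 := by
    rw [(Submodule.equivMapOfInjective F.subtype F.injective_subtype _).finrank_eq.symm,
      finrank_span_eq_card hv, Fintype.card_fin]
  refine iInf₂_le_of_le S ⟨hS, ?_⟩ (iSup₂_le ?_)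
  · rintro u ⟨w, -, rfl⟩
    exact (hF w).1
  · rintro u ⟨⟨w, hw, rfl⟩, hu⟩
    have hw0 : w ≠ 0 := fun h => hu (by simp [h])
    have hpos : 0 < ‖w‖ ^ 2 := by positivity
    have hden : ∫⁻ x, ‖(F.subtype w) x‖ₑ ^ 2 = ENNReal.ofReal (‖w‖ ^ 2) := by
      rw [lintegral_enorm_sq, ENNReal.ofReal_pow (norm_nonneg _)]
      congr 1
      rw [Submodule.coe_norm, Lp.norm_def, ENNReal.ofReal_toReal (Lp.eLpNorm_ne_top _)]
      rfl
    rw [hden]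
    change dirichletEnergy ((w : Lp ℝ 2 (volume : Measure (Euc d))) : Euc d → ℝ) / _ ≤ _
    rw [(hF w).2, ← ENNReal.ofReal_div_of_pos hpos]
    refine ENNReal.ofReal_le_ofReal ?_
    rw [div_le_iff₀ hpos, hD, ← e.sum_sq_norm_inner_right w, Finset.mul_sum]
    refine Finset.sum_le_sum fun j _ => ?_
    rw [Real.norm_eq_abs, sq_abs]
    rcases le_or_gt j i with hji | hij
    · exact mul_le_mul_of_nonneg_right (hμ hji) (sq_nonneg _)
    · have : inner ℝ (e j) w = 0 := by
        refine Submodule.span_induction (p := fun w _ => inner ℝ (e j) w = 0) ?_ ?_ ?_ ?_ hw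
        · rintro _ ⟨l, rfl⟩
          simp only [v]
          rw [e.inner_eq_ite, if_neg]
          intro h
          have := l.2
          rw [h, Fin.lt_def] at hij
          simp at hij
          omega
        · simp
        · intro x y _ _ hx hy; rw [inner_add_right, hx, hy, add_zero]
        · intro a x _ hx; rw [inner_smul_right, hx, mul_zero]
      simp [this]

theorem eigenvalueSum_le_of_testFunctions {k : ℕ} {Ω : Set (Euc d)} {ψ : Fin k → Euc d → ℝ}
    (hψ : ∀ i, IsTestFunction Ω (ψ i)) {θ : ℝ} (hθ : 0 < θ)
    (hG : ∀ c : Fin k → ℝ,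
      θ * ∑ i, c i ^ 2 ≤ (eLpNorm (fun x => ∑ i, c i * ψ i x) 2 volume).toReal ^ 2) :
    eigenvalueSum k Ω ≤
      ENNReal.ofReal (θ⁻¹ * ∑ i, (eLpNorm (gradient (ψ i)) 2 volume).toReal ^ 2) := by
  let f : Fin k → Lp ℝ 2 (volume : Measure (Euc d)) := fun i => ((hψ i).memLp 2).toLp (ψ i)
  let h : Fin k → Lp (Euc d) 2 (volume : Measure (Euc d)) :=
    fun i => ((hψ i).memLp_gradient 2).toLp (gradient (ψ i))
  have hc : ∀ c : Fin k → ℝ, IsTestFunction Ω (fun x => ∑ i, c i * ψ i x) := fun c =>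
    IsTestFunction.sum _ fun i => (hψ i).const_mul (c i)
  have hf : ∀ c : Fin k → ℝ, ∑ i, c i • f i = ((hc c).memLp 2).toLp _ := fun c => by
    ext1
    refine (Lp.coeFn_fun_finsetSum _ _).trans ?_
    refine EventuallyEq.trans ?_ (MemLp.coeFn_toLp _).symm
    have h1 : ∀ᵐ x, ∀ i, (c i • f i) x = c i * f i x := ae_all_iff.2 fun i => Lp.coeFn_smul _ _
    have h2 : ∀ᵐ x, ∀ i, f i x = ψ i x := ae_all_iff.2 fun i => MemLp.coeFn_toLp _
    filter_upwards [h1, h2] with x hx1 hx2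
    simp [hx1, hx2]
  have hh : ∀ c : Fin k → ℝ, ∑ i, c i • h i = ((hc c).memLp_gradient 2).toLp _ := fun c => by
    ext1
    refine (Lp.coeFn_fun_finsetSum _ _).trans ?_
    refine EventuallyEq.trans ?_ (MemLp.coeFn_toLp _).symm
    have h1 : ∀ᵐ x, ∀ i, (c i • h i) x = c i • h i x := ae_all_iff.2 fun i => Lp.coeFn_smul _ _
    have h2 : ∀ᵐ x, ∀ i, h i x = gradient (ψ i) x := ae_all_iff.2 fun i => MemLp.coeFn_toLp _
    filter_upwards [h1, h2] with x hx1 hx2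
    rw [gradient_sum_const_mul _ _ fun i => (hψ i).differentiable]
    simp [hx1, hx2]
  have hGf : ∀ c : Fin k → ℝ, θ * ∑ i, c i ^ 2 ≤ ‖∑ i, c i • f i‖ ^ 2 := fun c => by
    rw [hf, Lp.norm_toLp]; exact hG c
  have hli : LinearIndependent ℝ f := by
    rw [Fintype.linearIndependent_iff]
    intro c hc0
    have h1 := hGf c
    rw [hc0, norm_zero] at h1
    have h2 : ∑ i, c i ^ 2 = 0 :=
      le_antisymm (by nlinarith) (Finset.sum_nonneg fun i _ => sq_nonneg _)
    intro i
    have := (Finset.sum_eq_zero_iff_of_nonneg fun i _ => sq_nonneg (c i)).1 h2 i (Finset.mem_univ i)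
    exact pow_eq_zero_iff (two_ne_zero) |>.1 this
  obtain ⟨F, b, hb⟩ : ∃ (F : Submodule ℝ (Lp ℝ 2 (volume : Measure (Euc d))))
      (b : Module.Basis (Fin k) ℝ F), ∀ i, (b i : Lp ℝ 2 (volume : Measure (Euc d))) = f i :=
    ⟨_, Module.Basis.span hli, fun i => by rw [Module.Basis.span_apply]⟩
  have hbf : ∀ c : Fin k → ℝ,
      ((∑ i, c i • b i : F) : Lp ℝ 2 (volume : Measure (Euc d))) = ∑ i, c i • f i := fun c => by
    rw [Submodule.coe_sum]
    exact Finset.sum_congr rfl fun i _ => by rw [Submodule.coe_smul, hb]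
  have : FiniteDimensional ℝ F := b.finiteDimensional_of_finite
  -- The gradient as a linear map on the span of the `ψ i` in L², defined on a basis; linear
  -- independence comes from θ > 0.
  obtain ⟨D, hDb⟩ : ∃ D : F →ₗ[ℝ] Lp (Euc d) 2 (volume : Measure (Euc d)), ∀ i, D (b i) = h i :=
    ⟨b.constr ℝ h, fun i => b.constr_basis ℝ h i⟩
  have hDf : ∀ c : Fin k → ℝ, D (∑ i, c i • b i) = ∑ i, c i • h i := fun c => by
    rw [map_sum]
    exact Finset.sum_congr rfl fun i _ => by rw [map_smul, hDb]
  have hF : ∀ u : F, MemH10 Ω (u : Lp ℝ 2 (volume : Measure (Euc d))) ∧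
      dirichletEnergy (u : Lp ℝ 2 (volume : Measure (Euc d))) = ENNReal.ofReal (‖D u‖ ^ 2) := by
    intro u
    obtain ⟨c, hu⟩ : ∃ c : Fin k → ℝ, ∑ i, c i • b i = u := ⟨_, b.sum_repr u⟩
    have h1 : (u : Lp ℝ 2 (volume : Measure (Euc d))) = ((hc c).memLp 2).toLp _ := by
      rw [← hf, ← hu, hbf]
    have h2 : D u = ((hc c).memLp_gradient 2).toLp _ := by
      rw [← hh, ← hu, hDf]
    have h3 : (u : Lp ℝ 2 (volume : Measure (Euc d))) =ᵐ[volume] fun x => ∑ i, c i * ψ i x := by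
      rw [h1]; exact MemLp.coeFn_toLp _
    refine ⟨(hc c).memH10 h3, ?_⟩
    rw [(hc c).dirichletEnergy_eq h3, h2, Lp.norm_toLp, ENNReal.ofReal_pow ENNReal.toReal_nonneg,
      ENNReal.ofReal_toReal ((hc c).memLp_gradient 2).eLpNorm_ne_top]
  obtain ⟨e, μ, hμ, hD⟩ := exists_orthonormalBasis_diagonalizing
    (by rw [Module.finrank_eq_card_basis b, Fintype.card_fin] : Module.finrank ℝ F = k) D
  have hμ0 : ∀ j, 0 ≤ μ j := fun j => by
    have := hD (e j)
    rw [Finset.sum_eq_single j] at this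
    · simp at this; rw [← this]; positivity
    · intro i _ hij; simp [e.inner_eq_ite, hij]
    · simp
  have htr := mul_sum_le_sum_norm_sq_of_diagonalizing D e μ hD b b.span_eq θ (fun c => by
    refine (hGf c).trans_eq ?_
    rw [← hbf, Submodule.coe_norm])
  calc eigenvalueSum k Ω ≤ ∑ i, ENNReal.ofReal (μ i) :=
        Finset.sum_le_sum fun i _ => dirichletEigenvalue_le D hF e hμ hD i
    _ = ENNReal.ofReal (∑ i, μ i) := (ENNReal.ofReal_sum_of_nonneg fun i _ => hμ0 i).symm
    _ ≤ _ := by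
      refine ENNReal.ofReal_le_ofReal ?_
      rw [inv_mul_eq_div, le_div_iff₀ hθ, mul_comm]
      refine htr.trans_eq ?_
      simp [hDb, h, Lp.norm_toLp]

/-! ### Scaling and optimality -/

theorem eLpNorm_two_comp_smul_sq {E : Type*} [NormedAddCommGroup E] (f : Euc d → E) {r : ℝ}
    (hr : 0 < r) :
    eLpNorm (fun x => f (r • x)) 2 volume ^ 2 =
      ENNReal.ofReal (r ^ d)⁻¹ * eLpNorm f 2 volume ^ 2 := by
  rw [← lintegral_enorm_sq, ← lintegral_enorm_sq]
  have h := lintegral_map_equiv (μ := (volume : Measure (Euc d))) (fun x => ‖f x‖ₑ ^ 2)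
    (Homeomorph.smulOfNeZero r hr.ne' : Euc d ≃ₜ Euc d).toMeasurableEquiv
  have hm := Measure.map_addHaar_smul (volume : Measure (Euc d)) hr.ne'
  change ∫⁻ x, ‖f x‖ₑ ^ 2 ∂(Measure.map (r • ·) volume) = ∫⁻ x, ‖f (r • x)‖ₑ ^ 2 at h
  rw [← h, hm, lintegral_smul_measure, finrank_euclideanSpace_fin,
    abs_of_pos (by positivity : 0 < (r ^ d)⁻¹), smul_eq_mul]

theorem toReal_eLpNorm_two_comp_smul_sq {E : Type*} [NormedAddCommGroup E] (f : Euc d → E)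
    {r : ℝ} (hr : 0 < r) :
    (eLpNorm (fun x => f (r • x)) 2 volume).toReal ^ 2 =
      (r ^ d)⁻¹ * (eLpNorm f 2 volume).toReal ^ 2 := by
  rw [← ENNReal.toReal_pow, eLpNorm_two_comp_smul_sq f hr, ENNReal.toReal_mul,
    ENNReal.toReal_ofReal (by positivity), ENNReal.toReal_pow]

/-- The dilate r⁻¹O with r = |O|^(1/d) has unit volume and is admissible. Under x ↦ r x energies
scale by r^(2-d) and the Gram bound by r^(-d), leaving the factor r² = |O|^(2/d). -/
theorem IsOptimalSet.eigenvalueSum_le {k : ℕ} (hd : 1 ≤ d) (hk : 1 ≤ k) {Ω : Set (Euc d)}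
    (hΩ : IsOptimalSet k Ω) {O : Set (Euc d)} (hO : IsOpen O) (hO' : volume O ≠ ⊤)
    {ψ : Fin k → Euc d → ℝ} (hψ : ∀ i, IsTestFunction O (ψ i)) {θ : ℝ} (hθ : 0 < θ)
    (hG : ∀ c : Fin k → ℝ,
      θ * ∑ i, c i ^ 2 ≤ (eLpNorm (fun x => ∑ i, c i * ψ i x) 2 volume).toReal ^ 2) :
    eigenvalueSum k Ω ≤ ENNReal.ofReal ((volume O).toReal ^ (2 / d : ℝ) *
      (θ⁻¹ * ∑ i, (eLpNorm (gradient (ψ i)) 2 volume).toReal ^ 2)) := by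
  have hd0 : (d : ℝ) ≠ 0 := by positivity
  -- On the empty set every `ψ i` vanishes, contradicting the Gram bound at c = (1, …, 1) since k ≥
  -- 1.
  have hne : O.Nonempty := by
    rw [Set.nonempty_iff_ne_empty]
    rintro rfl
    have h0 : ∀ i, ψ i = 0 := fun i => tsupport_eq_empty_iff.1 (Set.subset_empty_iff.1 (hψ i).2.2)
    have := hG fun _ => 1
    simp [h0] at this
    have hk' : (0 : ℝ) < k := by exact_mod_cast hk
    nlinarith
  have hm : 0 < (volume O).toReal := ENNReal.toReal_pos (hO.measure_pos _ hne).ne' hO'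
  set m := (volume O).toReal with hmdef
  set r : ℝ := m ^ (1 / d : ℝ) with hrdef
  have hr : 0 < r := by positivity
  have hrd : r ^ d = m := by
    rw [hrdef, ← Real.rpow_natCast, ← Real.rpow_mul hm.le, one_div_mul_cancel hd0, Real.rpow_one]
  have hr2 : r ^ 2 = m ^ (2 / d : ℝ) := by
    rw [hrdef, ← Real.rpow_natCast, ← Real.rpow_mul hm.le]
    congr 1; push_cast; ring
  have hvol : volume ((fun x => r • x) ⁻¹' O) = 1 := by
    rw [Measure.addHaar_preimage_smul _ hr.ne', finrank_euclideanSpace_fin, hrd,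
      abs_of_pos (by positivity), (ENNReal.ofReal_toReal hO').symm, ← hmdef,
      ← ENNReal.ofReal_mul (by positivity), inv_mul_cancel₀ hm.ne', ENNReal.ofReal_one]
  refine (hΩ.2.2 _ (hO.preimage (continuous_const_smul r)) hvol).trans ?_
  refine (eigenvalueSum_le_of_testFunctions (θ := (r ^ d)⁻¹ * θ)
    (fun i => (hψ i).comp_smul hr.ne') (by positivity) fun c => ?_).trans ?_
  · rw [toReal_eLpNorm_two_comp_smul_sq (fun x => ∑ i, c i * ψ i x) hr, mul_assoc]
    exact mul_le_mul_of_nonneg_left (hG c) (by positivity)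
  · refine le_of_eq (congrArg _ ?_)
    have h1 : ∀ i, (eLpNorm (gradient fun x => ψ i (r • x)) 2 volume).toReal ^ 2 =
        r ^ 2 * ((r ^ d)⁻¹ * (eLpNorm (gradient (ψ i)) 2 volume).toReal ^ 2) := fun i => by
      have : (gradient fun x => ψ i (r • x)) = r • fun x => gradient (ψ i) (r • x) := by
        ext1 x; exact gradient_comp_smul (hψ i).differentiable r x
      rw [this, eLpNorm_const_smul, ENNReal.toReal_mul, mul_pow,
        toReal_eLpNorm_two_comp_smul_sq _ hr]
      simp
    simp only [h1, ← Finset.mul_sum, hrd, ← hr2]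
    field_simp

/-! ### Truncation and approximation from open sets -/

/-- A smooth nondecreasing contraction of `ℝ` which vanishes near `0` and stays at bounded
distance from the identity. -/
theorem exists_smooth_softThreshold :
    ∃ T : ℝ → ℝ, ContDiff ℝ ∞ T ∧ (∀ s, |s| ≤ 1 → T s = 0) ∧ (∀ s, |deriv T s| ≤ 1) ∧
      ∃ C, ∀ s, |s - T s| ≤ C := by
  -- The threshold is the primitive of this cutoff, which is 0 for |s| ≤ 1 and 1 for s² ≥ 2; its
  -- distance to the identity is at most ∫|1 - χ|.
  let χ : ℝ → ℝ := fun s => Real.smoothTransition (s ^ 2 - 1)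
  have hχ : ContDiff ℝ ∞ χ := Real.smoothTransition.contDiff.comp (by fun_prop)
  have hχc : Continuous χ := hχ.continuous
  have hd : ∀ s, HasDerivAt (fun s => ∫ σ in (0 : ℝ)..s, χ σ) (χ s) s := fun s =>
    intervalIntegral.integral_hasDerivAt_right (hχc.intervalIntegrable _ _)
      hχc.stronglyMeasurable.stronglyMeasurableAtFilter hχc.continuousAt
  have hderiv : deriv (fun s => ∫ σ in (0 : ℝ)..s, χ σ) = χ := funext fun s => (hd s).deriv
  refine ⟨fun s => ∫ σ in (0 : ℝ)..s, χ σ, ?_, fun s hs => ?_, fun s => ?_,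
    ∫ σ, |1 - χ σ|, fun s => ?_⟩
  · rw [contDiff_infty_iff_deriv, hderiv]
    exact ⟨fun s => (hd s).differentiableAt, hχ⟩
  · refine intervalIntegral.integral_zero_ae (Eventually.of_forall fun σ hσ => ?_)
    refine Real.smoothTransition.zero_of_nonpos ?_
    have h1 : |σ| ≤ |s| := by
      rcases Set.mem_uIoc.1 hσ with h | h
      · rw [abs_of_pos h.1, abs_of_pos (h.1.trans_le h.2)]; exact h.2
      · rw [abs_of_nonpos h.2, abs_of_neg (h.1.trans_le h.2)]; linarith [h.1]
    nlinarith [sq_abs σ, abs_nonneg σ, abs_nonneg s]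
  · rw [hderiv, abs_of_nonneg (Real.smoothTransition.nonneg _)]
    exact Real.smoothTransition.le_one _
  · have hcs : HasCompactSupport fun σ => 1 - χ σ := by
      refine HasCompactSupport.of_support_subset_isCompact (isCompact_Icc (a := (-2 : ℝ)) (b := 2)) ?_
      intro σ hσ
      by_contra h
      refine hσ ?_
      have : 1 ≤ σ ^ 2 - 1 := by
        rw [Set.mem_Icc, not_and_or] at h
        rcases h with h | h <;> nlinarith
      simp [χ, Real.smoothTransition.one_of_one_le this]
    have hint : Integrable fun σ => 1 - χ σ :=
      (continuous_const.sub hχc).integrable_of_hasCompactSupport hcs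
    have h1 : s - ∫ σ in (0 : ℝ)..s, χ σ = ∫ σ in (0 : ℝ)..s, (1 - χ σ) := by
      rw [intervalIntegral.integral_sub (by simp) (hχc.intervalIntegrable _ _)]
      simp
    rw [h1]
    calc |∫ σ in (0 : ℝ)..s, (1 - χ σ)| ≤ ∫ σ in Set.uIoc 0 s, |1 - χ σ| :=
          intervalIntegral.norm_integral_le_integral_norm_uIoc (f := fun σ => 1 - χ σ)
      _ ≤ _ := setIntegral_le_integral hint.norm (Eventually.of_forall fun _ => abs_nonneg _)

theorem abs_sub_le_of_abs_deriv_le_one {T : ℝ → ℝ} (hT : Differentiable ℝ T)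
    (h : ∀ s, |deriv T s| ≤ 1) (a b : ℝ) : |T a - T b| ≤ |a - b| := by
  have := (lipschitzWith_of_nnnorm_deriv_le (C := 1) hT (fun s => by
    rw [← NNReal.coe_le_coe]; simpa using h s)).dist_le_mul a b
  simpa [Real.dist_eq] using this

/-- Rescalings of the soft threshold: contractions vanishing on `[-t, t]`. -/
theorem exists_smooth_softThreshold_scaled :
    ∃ C : ℝ, ∀ t : ℝ, 0 < t → ∃ T : ℝ → ℝ, ContDiff ℝ ∞ T ∧ (∀ s, |s| ≤ t → T s = 0) ∧
      (∀ s, |deriv T s| ≤ 1) ∧ (∀ a b, |T a - T b| ≤ |a - b|) ∧ ∀ s, |s - T s| ≤ C * t := by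
  obtain ⟨T, hT, h0, hd, C, hC⟩ := exists_smooth_softThreshold
  refine ⟨C, fun t ht => ?_⟩
  have hTd : Differentiable ℝ T := hT.differentiable (by simp)
  have hS : ContDiff ℝ ∞ (fun s => t * T (s / t)) :=
    contDiff_const.mul (hT.comp (contDiff_id.div_const t))
  have hder : ∀ s, deriv (fun s => t * T (s / t)) s = deriv T (s / t) := fun s => by
    have h1 : HasDerivAt (fun s : ℝ => s / t) (1 / t) s := (hasDerivAt_id s).div_const t
    have h2 := ((hTd (s / t)).hasDerivAt.comp s h1).const_mul t
    rw [show deriv T (s / t) = t * (deriv T (s / t) * (1 / t)) by field_simp]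
    exact h2.deriv
  refine ⟨fun s => t * T (s / t), hS, fun s hs => ?_, fun s => ?_, ?_, fun s => ?_⟩
  · change t * T (s / t) = 0
    rw [h0 _ (by rw [abs_div, abs_of_pos ht, div_le_one ht]; exact hs), mul_zero]
  · rw [hder]; exact hd _
  · exact abs_sub_le_of_abs_deriv_le_one (hS.differentiable (by simp))
      (fun s => by rw [hder]; exact hd _)
  · have h1 : s - t * T (s / t) = t * (s / t - T (s / t)) := by field_simp
    rw [h1, abs_mul, abs_of_pos ht, mul_comm]
    exact mul_le_mul_of_nonneg_right (hC _) ht.le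

theorem MemH10.weakGrad_spec {Ω : Set (Euc d)} {u : Euc d → ℝ} (h : MemH10 Ω u) :
    MemLp (weakGrad u) 2 volume ∧ HasWeakGradient u (weakGrad u) ∧
    ∃ φ : ℕ → Euc d → ℝ, (∀ n, IsTestFunction Ω (φ n)) ∧
      Tendsto (fun n => eLpNorm (fun x => u x - φ n x) 2 volume) atTop (𝓝 0) ∧
      Tendsto (fun n => eLpNorm (fun x => weakGrad u x - gradient (φ n) x) 2 volume)
        atTop (𝓝 0) := by
  obtain ⟨-, g, hg, hug, φ, hφ, h1, h2⟩ := h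
  have e := weakGrad_ae_eq hg hug
  refine ⟨(memLp_congr_ae e).2 hg, fun ψ hψ v => ?_, φ, hφ, h1, ?_⟩
  · rw [hug ψ hψ v]
    congr 1
    refine integral_congr_ae ?_
    filter_upwards [e] with x hx
    rw [hx]
  · refine h2.congr fun n => eLpNorm_congr_ae ?_
    filter_upwards [e] with x hx
    rw [hx]

/-- Take ψ = T(φₙ), with φₙ → v in H¹ and T a contraction vanishing on [-t, t], and O = {|φₙ| >
t/2}. Truncation does not increase the gradient. At points of O where v = 0 one has |v - φₙ| > t/2,
so Chebyshev makes that set small. The level t is fixed before n. -/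
theorem MemH10.exists_testFunction_of_pos {v : Euc d → ℝ} (hv : MemH10 Set.univ v) {η : ℝ}
    (hη : 0 < η) :
    ∃ (ψ : Euc d → ℝ) (O : Set (Euc d)), IsOpen O ∧ IsTestFunction O ψ ∧
      eLpNorm (fun x => v x - ψ x) 2 volume ≤ ENNReal.ofReal η ∧
      eLpNorm (gradient ψ) 2 volume ≤ eLpNorm (weakGrad v) 2 volume + ENNReal.ofReal η ∧
      volume (O \ {x | v x ≠ 0}) ≤ ENNReal.ofReal η := by
  obtain ⟨hg, -, φ, hφ, h1, h2⟩ := hv.weakGrad_spec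
  have hv2 := hv.1
  obtain ⟨C, hC⟩ := exists_smooth_softThreshold_scaled
  choose! T hTs hT0 hTd hTl hTC using hC
  have hTc : ∀ t, 0 < t → Continuous (T t) := fun t ht => (hTs t ht).continuous
  obtain ⟨t, ht, hvt⟩ : ∃ t, 0 < t ∧
      eLpNorm (fun x => v x - T t (v x)) 2 volume ≤ ENNReal.ofReal (η / 2) := by
    have hlim : Tendsto (fun n : ℕ => ∫⁻ x : Euc d, ‖v x - T (1 / (n + 1 : ℝ)) (v x)‖ₑ ^ 2) atTop
        (𝓝 (∫⁻ _ : Euc d, 0)) := by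
      have hpos : ∀ n : ℕ, (0 : ℝ) < 1 / (n + 1) := fun n => by positivity
      refine tendsto_lintegral_of_dominated_convergence' (fun x => ‖2 * v x‖ₑ ^ 2) (fun n => ?_)
        (fun n => ?_) ?_ ?_
      · exact (hv2.aestronglyMeasurable.sub
          ((hTc _ (hpos n)).comp_aestronglyMeasurable hv2.aestronglyMeasurable)).enorm.pow_const 2
      · refine Eventually.of_forall fun x => ?_
        have h3 := hTl _ (hpos n) (v x) 0
        rw [hT0 _ (hpos n) 0 (by simpa using (hpos n).le), sub_zero, sub_zero] at h3
        refine pow_le_pow_left' (enorm_le_iff_norm_le.2 ?_) 2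
        rw [Real.norm_eq_abs, Real.norm_eq_abs, abs_mul, abs_two]
        exact (abs_sub _ _).trans (by linarith)
      · rw [lintegral_enorm_sq]
        exact ENNReal.pow_ne_top (hv2.const_mul 2).eLpNorm_ne_top
      · refine Eventually.of_forall fun x => ?_
        have : Tendsto (fun n : ℕ => v x - T (1 / (n + 1 : ℝ)) (v x)) atTop (𝓝 0) := by
          refine squeeze_zero_norm (fun n => hTC _ (hpos n) _) ?_
          simpa using (tendsto_one_div_add_atTop_nhds_zero_nat (𝕜 := ℝ)).const_mul C
        have := ENNReal.Tendsto.pow (n := 2) this.enorm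
        simpa using this
    simp only [lintegral_zero, lintegral_enorm_sq] at hlim
    have hpos : (0 : ℝ≥0∞) < ENNReal.ofReal (η / 2) ^ 2 :=
      ENNReal.pow_pos (by simpa using hη) 2
    obtain ⟨n, hn⟩ := (hlim.eventually_le_const hpos).exists
    exact ⟨1 / (n + 1), by positivity, (ENNReal.pow_le_pow_left_iff two_ne_zero).1 hn⟩
  have hδ : (0 : ℝ≥0∞) < ENNReal.ofReal (η / 2) := by simpa using hη
  have hδ' : (0 : ℝ≥0∞) < ENNReal.ofReal η := by simpa using hη
  have hlim3 : Tendsto (fun n => (ENNReal.ofReal (t / 2))⁻¹ ^ 2 *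
      eLpNorm (fun x => v x - φ n x) 2 volume ^ 2) atTop (𝓝 0) := by
    have : (ENNReal.ofReal (t / 2))⁻¹ ^ 2 ≠ ⊤ :=
      ENNReal.pow_ne_top (ENNReal.inv_ne_top.2 (by simpa using ht))
    simpa using ENNReal.Tendsto.const_mul (ENNReal.Tendsto.pow (n := 2) h1) (Or.inr this)
  obtain ⟨n, hn1, hn2, hn3⟩ := ((h1.eventually_le_const hδ).and
    ((h2.eventually_le_const hδ').and (hlim3.eventually_le_const hδ'))).exists
  have hφd := (hφ n).differentiable
  have hsupp : tsupport (fun x => T t (φ n x)) ⊆ {x | t ≤ |φ n x|} := by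
    refine closure_minimal (fun x hx => ?_)
      (isClosed_le continuous_const (hφ n).1.continuous.abs)
    by_contra h
    exact hx (hT0 t ht _ (not_le.1 h).le)
  refine ⟨fun x => T t (φ n x), {x | t / 2 < |φ n x|}, ?_, ⟨?_, ?_, ?_⟩, ?_, ?_, ?_⟩
  · exact isOpen_lt continuous_const (hφ n).1.continuous.abs
  · exact (hTs t ht).comp (hφ n).1
  · exact (hφ n).2.1.comp_left (hT0 t ht 0 (by simpa using ht.le))
  · exact hsupp.trans fun x (hx : t ≤ |φ n x|) => show t / 2 < |φ n x| by linarith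
  · have e : (fun x => v x - T t (φ n x)) =
        (fun x => v x - T t (v x)) + fun x => T t (v x) - T t (φ n x) := by
      ext x; simp
    have m1 := (hTc t ht).comp_aestronglyMeasurable hv2.aestronglyMeasurable
    have m2 := (hTc t ht).comp_aestronglyMeasurable (hφ n).1.continuous.aestronglyMeasurable
      (μ := volume)
    rw [e]
    refine (eLpNorm_add_le (hv2.aestronglyMeasurable.sub m1) (m1.sub m2) one_le_two).trans ?_
    rw [← add_halves η, ENNReal.ofReal_add (by positivity) (by positivity)]
    refine add_le_add hvt (le_trans (eLpNorm_mono fun x => ?_) (by simpa using hn1))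
    exact hTl t ht _ _
  · have e : eLpNorm (gradient fun x => T t (φ n x)) 2 volume ≤
        eLpNorm (gradient (φ n)) 2 volume := by
      refine eLpNorm_mono fun x => ?_
      rw [gradient_comp_real hφd ((hTs t ht).differentiable (by simp)), norm_smul]
      exact mul_le_of_le_one_left (norm_nonneg _) (hTd t ht _)
    refine e.trans ?_
    have e2 : gradient (φ n) =
        weakGrad v - fun x => weakGrad v x - gradient (φ n) x := by ext1 x; simp
    calc eLpNorm (gradient (φ n)) 2 volume
        = eLpNorm (weakGrad v - fun x => weakGrad v x - gradient (φ n) x) 2 volume := by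
          rw [← e2]
      _ ≤ _ := (eLpNorm_sub_le hg.1 (hg.1.sub ((hφ n).memLp_gradient 2).1) one_le_two).trans
        (add_le_add_right hn2 _)
  · have hm : AEStronglyMeasurable (fun x => v x - φ n x) volume :=
      hv2.1.sub ((hφ n).memLp 2).1
    have := meas_ge_le_mul_pow_eLpNorm_enorm volume two_ne_zero (by simp) hm
      (ε := ENNReal.ofReal (t / 2)) (by simpa using ht) (by simp)
    simp only [ENNReal.toReal_ofNat, ENNReal.rpow_ofNat] at this
    refine (measure_mono ?_).trans (this.trans hn3)
    rintro x ⟨hx, hx0⟩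
    have hx0 : v x = 0 := not_not.1 hx0
    simp only [Set.mem_ofPred_eq] at hx ⊢
    rw [hx0, zero_sub, enorm_neg, Real.enorm_eq_ofReal_abs]
    exact ENNReal.ofReal_le_ofReal hx.le

theorem abs_apply_le_norm {k : ℕ} (v : Euc k) (i : Fin k) : |v i| ≤ ‖v‖ := by
  simpa using PiLp.norm_apply_le v i

/-- The triangle inequality in L²: since |cᵢ| ≤ |c|, replacing v by ψ changes the norm of the
combination by at most kη|c|. -/
theorem sq_eLpNorm_sum_sub_le {k : ℕ} {v ψ : Fin k → Euc d → ℝ} (hv : ∀ i, MemLp (v i) 2 volume)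
    (hψ : ∀ i, MemLp (ψ i) 2 volume) {η θ : ℝ} (hη : 0 ≤ η) (hθ : 0 ≤ θ) (hk : k * η ≤ √θ)
    (h : ∀ i, eLpNorm (fun x => v i x - ψ i x) 2 volume ≤ ENNReal.ofReal η)
    (hG : ∀ c : Fin k → ℝ,
      θ * ∑ i, c i ^ 2 ≤ (eLpNorm (fun x => ∑ i, c i * v i x) 2 volume).toReal ^ 2)
    (c : Fin k → ℝ) :
    (√θ - k * η) ^ 2 * ∑ i, c i ^ 2 ≤
      (eLpNorm (fun x => ∑ i, c i * ψ i x) 2 volume).toReal ^ 2 := by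
  set r := √(∑ i, c i ^ 2) with hr
  have hr2 : r ^ 2 = ∑ i, c i ^ 2 := Real.sq_sqrt (Finset.sum_nonneg fun i _ => sq_nonneg _)
  have hci : ∀ i, |c i| ≤ r := fun i => by
    rw [hr, ← Real.sqrt_sq_eq_abs]
    exact Real.sqrt_le_sqrt
      (Finset.single_le_sum (f := fun i => c i ^ 2) (fun i _ => sq_nonneg _) (Finset.mem_univ i))
  have hcv : MemLp (fun x => ∑ i, c i * v i x) 2 volume :=
    memLp_finsetSum _ fun i _ => (hv i).const_mul _
  have hcψ : MemLp (fun x => ∑ i, c i * ψ i x) 2 volume :=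
    memLp_finsetSum _ fun i _ => (hψ i).const_mul _
  set a := (eLpNorm (fun x => ∑ i, c i * v i x) 2 volume).toReal with ha
  set b := (eLpNorm (fun x => ∑ i, c i * ψ i x) 2 volume).toReal with hb
  have h1 : √θ * r ≤ a := by
    refine abs_le_of_sq_le_sq' ?_ ENNReal.toReal_nonneg |>.2
    rw [mul_pow, Real.sq_sqrt hθ, hr2]
    exact hG c
  have h2 : eLpNorm (fun x => ∑ i, c i * (v i x - ψ i x)) 2 volume ≤ ENNReal.ofReal (k * η * r) := by
    have e : (fun x => ∑ i, c i * (v i x - ψ i x)) =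
        ∑ i, c i • fun x => v i x - ψ i x := by
      ext x; simp
    rw [e]
    refine (eLpNorm_sum_le (fun i _ => ((hv i).sub (hψ i)).1.const_smul (c i)) one_le_two).trans ?_
    calc _ ≤ ∑ _i : Fin k, ENNReal.ofReal (r * η) := Finset.sum_le_sum fun i _ => by
          rw [eLpNorm_const_smul, ENNReal.ofReal_mul (Real.sqrt_nonneg _),
            Real.enorm_eq_ofReal_abs]
          exact mul_le_mul' (ENNReal.ofReal_le_ofReal (hci i)) (h i)
      _ = _ := by
          rw [Finset.sum_const, Finset.card_univ, Fintype.card_fin, nsmul_eq_mul, mul_assoc,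
            ENNReal.ofReal_mul (by positivity : (0 : ℝ) ≤ k), ENNReal.ofReal_natCast, mul_comm r]
  have h3 : a ≤ b + k * η * r := by
    have e : (fun x => ∑ i, c i * v i x) =
        (fun x => ∑ i, c i * ψ i x) + fun x => ∑ i, c i * (v i x - ψ i x) := by
      ext x
      rw [Pi.add_apply, ← Finset.sum_add_distrib]
      exact Finset.sum_congr rfl fun i _ => by ring
    have hm : MemLp (fun x => ∑ i, c i * (v i x - ψ i x)) 2 volume :=
      memLp_finsetSum _ fun i _ => ((hv i).sub (hψ i)).const_mul _
    have h4 : eLpNorm (fun x => ∑ i, c i * v i x) 2 volume ≤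
        eLpNorm (fun x => ∑ i, c i * ψ i x) 2 volume + ENNReal.ofReal (k * η * r) := by
      rw [e]
      exact (eLpNorm_add_le hcψ.1 hm.1 one_le_two).trans (add_le_add_right h2 _)
    have := ENNReal.toReal_mono
      (ENNReal.add_ne_top.2 ⟨hcψ.eLpNorm_ne_top, ENNReal.ofReal_ne_top⟩) h4
    rwa [ENNReal.toReal_add hcψ.eLpNorm_ne_top ENNReal.ofReal_ne_top,
      ENNReal.toReal_ofReal (by positivity)] at this
  rw [← hr2, ← mul_pow]
  exact pow_le_pow_left₀ (mul_nonneg (sub_nonneg.2 hk) (Real.sqrt_nonneg _)) (by linarith) 2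

/-- Apply the bound for open sets to the union of the sets carrying the η-approximations of the
components, then let η → 0⁺. -/
theorem IsOptimalSet.eigenvalueSum_le_of_memH1Vec {k : ℕ} (hd : 1 ≤ d) (hk : 1 ≤ k)
    {Ω : Set (Euc d)} (hΩ : IsOptimalSet k Ω) {V : Euc d → Euc k} (hV : MemH1Vec V)
    (hA : volume {x | 0 < ‖V x‖} ≠ ⊤) {θ : ℝ} (hθ : 0 < θ)
    (hG : ∀ c : Fin k → ℝ,
      θ * ∑ i, c i ^ 2 ≤ (eLpNorm (fun x => ∑ i, c i * V x i) 2 volume).toReal ^ 2) :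
    eigenvalueSum k Ω ≤ ENNReal.ofReal ((volume {x | 0 < ‖V x‖}).toReal ^ (2 / d : ℝ) *
      (θ⁻¹ * ∑ i, (eLpNorm (weakGrad fun x => V x i) 2 volume).toReal ^ 2)) := by
  set A := {x | 0 < ‖V x‖} with hAdef
  set m := (volume A).toReal with hm
  have key : ∀ η : ℝ, 0 < η → k * η < √θ → eigenvalueSum k Ω ≤
      ENNReal.ofReal ((m + k * η) ^ (2 / d : ℝ) * (((√θ - k * η) ^ 2)⁻¹ *
        ∑ i, ((eLpNorm (weakGrad fun x => V x i) 2 volume).toReal + η) ^ 2)) := by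
    intro η hη hkη
    choose ψ O hO hψ h1 h2 h3 using fun i => (hV i).exists_testFunction_of_pos hη
    have hvol : volume (⋃ i, O i) ≤ ENNReal.ofReal (m + k * η) := by
      have hsub : (⋃ i, O i) ⊆ A ∪ ⋃ i, O i \ {x | V x i ≠ 0} := by
        intro x hx
        obtain ⟨i, hi⟩ := Set.mem_iUnion.1 hx
        by_cases h0 : V x i = 0
        · exact Or.inr (Set.mem_iUnion.2 ⟨i, hi, fun h => h h0⟩)
        · exact Or.inl ((abs_pos.2 h0).trans_le (abs_apply_le_norm _ i))
      calc volume (⋃ i, O i) ≤ volume A + ∑ i, volume (O i \ {x | V x i ≠ 0}) :=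
            (measure_mono hsub).trans ((measure_union_le _ _).trans
              (add_le_add_right (measure_iUnion_fintype_le _ _) _))
        _ ≤ ENNReal.ofReal m + ∑ _i : Fin k, ENNReal.ofReal η :=
            add_le_add (ENNReal.ofReal_toReal hA).ge (Finset.sum_le_sum fun i _ => h3 i)
        _ = _ := by
            rw [Finset.sum_const, Finset.card_univ, Fintype.card_fin, nsmul_eq_mul,
              ENNReal.ofReal_add ENNReal.toReal_nonneg (by positivity),
              ENNReal.ofReal_mul (by positivity : (0 : ℝ) ≤ k), ENNReal.ofReal_natCast]
    have hpos : 0 < (√θ - k * η) ^ 2 := by have := sub_pos.2 hkη; positivity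
    refine (hΩ.eigenvalueSum_le hd hk (isOpen_iUnion hO)
      (ne_top_of_le_ne_top ENNReal.ofReal_ne_top hvol)
      (fun i => (hψ i).mono (Set.subset_iUnion O i)) hpos
      (sq_eLpNorm_sum_sub_le (fun i => (hV i).1) (fun i => (hψ i).memLp 2) hη.le hθ.le hkη.le
        h1 hG)).trans (ENNReal.ofReal_le_ofReal ?_)
    have hm0 : 0 ≤ m := ENNReal.toReal_nonneg
    gcongr with i
    · exact ENNReal.toReal_le_of_le_ofReal (by positivity) hvol
    · have hn := (hV i).weakGrad_spec.1.eLpNorm_ne_top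
      have := ENNReal.toReal_mono (ENNReal.add_ne_top.2 ⟨hn, ENNReal.ofReal_ne_top⟩) (h2 i)
      rwa [ENNReal.toReal_add hn ENNReal.ofReal_ne_top, ENNReal.toReal_ofReal hη.le] at this
  have hlim : Tendsto (fun η : ℝ => ENNReal.ofReal ((m + k * η) ^ (2 / d : ℝ) *
      (((√θ - k * η) ^ 2)⁻¹ *
        ∑ i, ((eLpNorm (weakGrad fun x => V x i) 2 volume).toReal + η) ^ 2))) (𝓝[>] 0)
      (𝓝 (ENNReal.ofReal (m ^ (2 / d : ℝ) *
      (θ⁻¹ * ∑ i, (eLpNorm (weakGrad fun x => V x i) 2 volume).toReal ^ 2)))) := by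
    refine tendsto_nhdsWithin_of_tendsto_nhds (ENNReal.tendsto_ofReal ?_)
    have hc : ContinuousAt (fun η : ℝ => (m + k * η) ^ (2 / d : ℝ) *
      (((√θ - k * η) ^ 2)⁻¹ *
        ∑ i, ((eLpNorm (weakGrad fun x => V x i) 2 volume).toReal + η) ^ 2)) 0 := by
      -- The power is continuous even if m = 0, because its exponent 2/d is nonnegative.
      refine ContinuousAt.mul (ContinuousAt.rpow_const (by fun_prop) (Or.inr (by positivity)))
        (ContinuousAt.mul (ContinuousAt.inv₀ (by fun_prop) ?_) (by fun_prop))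
      have := Real.sqrt_pos.2 hθ
      simp [this.ne']
    have := hc.tendsto
    simpa [Real.sq_sqrt hθ.le] using this
  refine ge_of_tendsto hlim ?_
  have hsmall : ∀ᶠ η : ℝ in 𝓝[>] 0, k * η < √θ := by
    refine nhdsWithin_le_nhds ?_
    have hc : Continuous fun η : ℝ => (k : ℝ) * η := by fun_prop
    exact hc.continuousAt.eventually_lt_const (by simpa using hθ)
  filter_upwards [self_mem_nhdsWithin, hsmall] with η hη hkη
  exact key η hη hkη

/-! ### Energy and support of the eigenfunctions -/

theorem tendsto_integral_inner_of_tendsto_eLpNorm {α E : Type*} [MeasurableSpace α]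
    {μ : Measure α} [NormedAddCommGroup E] [InnerProductSpace ℝ E] {f : α → E}
    {g : ℕ → α → E} (hf : MemLp f 2 μ) (hg : ∀ n, MemLp (g n) 2 μ)
    (h : Tendsto (fun n => eLpNorm (fun x => f x - g n x) 2 μ) atTop (𝓝 0)) :
    Tendsto (fun n => ∫ x, inner ℝ (f x) (g n x) ∂μ) atTop (𝓝 (∫ x, inner ℝ (f x) (f x) ∂μ)) := by
  have hinner : ∀ {a b : α → E} (ha : MemLp a 2 μ) (hb : MemLp b 2 μ),
      inner ℝ (ha.toLp a) (hb.toLp b) = ∫ x, inner ℝ (a x) (b x) ∂μ := fun ha hb => by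
    rw [L2.inner_def]
    refine integral_congr_ae ?_
    filter_upwards [ha.coeFn_toLp, hb.coeFn_toLp] with x h1 h2
    rw [h1, h2]
  have hlim : Tendsto (fun n => (hg n).toLp (g n)) atTop (𝓝 (hf.toLp f)) := by
    rw [Lp.tendsto_Lp_iff_tendsto_eLpNorm'']
    refine h.congr fun n => ?_
    rw [← eLpNorm_neg]
    congr 1
    ext x
    simp
  simp only [← hinner hf (hg _), ← hinner hf hf]
  exact tendsto_const_nhds.inner hlim

/-- Test the equation with φₙ → u in H¹ and pass to the limit, which amounts to testing with u
itself. -/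
theorem IsWeakEigenfunction.dirichletEnergy_eq {Ω : Set (Euc d)} {μ : ℝ} {u : Euc d → ℝ}
    (h : IsWeakEigenfunction Ω μ u) (hu : ∫ x, u x * u x = 1) :
    dirichletEnergy u = ENNReal.ofReal μ := by
  obtain ⟨hg, -, φ, hφ, h1, h2⟩ := h.1.weakGrad_spec
  have l1 := tendsto_integral_inner_of_tendsto_eLpNorm hg (fun n => (hφ n).memLp_gradient 2) h2
  have l2 := tendsto_integral_inner_of_tendsto_eLpNorm h.1.1 (fun n => (hφ n).memLp 2) h1
  have hi : ∀ a b : ℝ, inner ℝ a b = a * b := fun a b => by simp [mul_comm]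
  simp only [hi, hu] at l2
  have l3 := l2.const_mul μ
  rw [mul_one] at l3
  have e := tendsto_nhds_unique l1 (l3.congr fun n => (h.2 _ (hφ n)).symm)
  simp only [real_inner_self_eq_norm_sq] at e
  rw [dirichletEnergy, ← e, ofReal_integral_eq_lintegral_ofReal (hg.integrable_norm_pow two_ne_zero)]
  · refine lintegral_congr fun x => ?_
    rw [ENNReal.ofReal_pow (norm_nonneg _), ofReal_norm]
  · exact Eventually.of_forall fun x => by positivity

theorem MemH10.ae_eq_zero_of_notMem {Ω : Set (Euc d)} (hΩ : MeasurableSet Ω) {u : Euc d → ℝ}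
    (h : MemH10 Ω u) : ∀ᵐ x, x ∉ Ω → u x = 0 := by
  obtain ⟨hu, g, -, -, φ, hφ, h1, -⟩ := h
  have hle : ∀ n, eLpNorm u 2 (volume.restrict Ωᶜ) ≤
      eLpNorm (fun x => u x - φ n x) 2 volume := fun n => by
    refine le_trans (le_of_eq (eLpNorm_congr_ae ?_))
      (eLpNorm_mono_measure _ Measure.restrict_le_self)
    filter_upwards [ae_restrict_mem hΩ.compl] with x hx
    have : φ n x = 0 := by
      by_contra h0
      exact hx ((hφ n).2.2 (subset_tsupport _ h0))
    rw [this, sub_zero]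
  have h0 : eLpNorm u 2 (volume.restrict Ωᶜ) = 0 :=
    le_antisymm (ge_of_tendsto' h1 hle) zero_le
  have := (eLpNorm_eq_zero_iff hu.1.restrict two_ne_zero).1 h0
  exact (ae_restrict_iff' hΩ.compl).1 this

theorem MemH10Vec.volume_norm_pos_le {k : ℕ} {Ω : Set (Euc d)} (hΩ : MeasurableSet Ω)
    {U : Euc d → Euc k} (h : MemH10Vec Ω U) : volume {x | 0 < ‖U x‖} ≤ volume Ω := by
  have h0 : ∀ᵐ x, ∀ i, x ∉ Ω → U x i = 0 := ae_all_iff.2 fun i => (h i).ae_eq_zero_of_notMem hΩ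
  refine measure_mono_ae ?_
  filter_upwards [h0] with x hx hpos
  by_contra hxΩ
  have : U x = 0 := by ext i; exact hx i hxΩ
  have hpos : 0 < ‖U x‖ := hpos
  simp [this] at hpos

theorem IsEigenfunctionVector.dirichletEnergyVec_le {k : ℕ} {Ω : Set (Euc d)} {U : Euc d → Euc k}
    (h : IsEigenfunctionVector Ω U) : dirichletEnergyVec U ≤ eigenvalueSum k Ω :=
  Finset.sum_le_sum fun i _ => by
    rw [(h.1 i).dirichletEnergy_eq (by simpa using h.2 i i)]
    -- Only an inequality, because `toReal` sends an infinite eigenvalue to 0; this direction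
    -- suffices.
    exact ENNReal.ofReal_toReal_le

/-! ### Volume penalization -/

/-- From m^(-p) ≥ 1 - p log m and log m ≤ m - 1. Equality at m = 1 is what dictates Λ = pS with p =
2/d. -/
theorem one_add_le_rpow_neg_add {m : ℝ} (hm : 0 < m) {p : ℝ} (hp : 0 ≤ p) :
    1 + p ≤ m ^ (-p) + p * m := by
  have h1 : m ^ (-p) = Real.exp (Real.log m * (-p)) := Real.rpow_def_of_pos hm _
  have h2 := Real.add_one_le_exp (Real.log m * (-p))
  have h3 := Real.log_le_sub_one_of_pos hm
  rw [h1]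
  nlinarith

/-- Scale-invariant comparison turned into a comparison with a volume penalization. -/
theorem IsOptimalSet.add_le_of_memH1Vec {k : ℕ} (hd : 1 ≤ d) (hk : 1 ≤ k)
    {Ω : Set (Euc d)} (hΩ : IsOptimalSet k Ω) {V : Euc d → Euc k} (hV : MemH1Vec V)
    {θ : ℝ} (hθ : 0 < θ)
    (hG : ∀ c : Fin k → ℝ,
      θ * ∑ i, c i ^ 2 ≤ (eLpNorm (fun x => ∑ i, c i * V x i) 2 volume).toReal ^ 2) :
    eigenvalueSum k Ω + lagrangeMultiplier k Ω ≤
      ENNReal.ofReal θ⁻¹ * dirichletEnergyVec V +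
        lagrangeMultiplier k Ω * volume {x | 0 < ‖V x‖} := by
  have hd0 : (0 : ℝ) < d := by exact_mod_cast hd
  have hdE : (2 / d : ℝ≥0∞) = ENNReal.ofReal (2 / d) := by
    rw [ENNReal.ofReal_div_of_pos hd0]; simp
  by_cases hS0 : eigenvalueSum k Ω = 0
  · simp [lagrangeMultiplier, hS0]
  by_cases hA : volume {x | 0 < ‖V x‖} = ⊤
  · have : lagrangeMultiplier k Ω ≠ 0 := by
      rw [lagrangeMultiplier, hdE]
      exact mul_ne_zero (by simpa using hd0) hS0
    rw [hA, ENNReal.mul_top this, add_top]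
    exact le_top
  have hle := hΩ.eigenvalueSum_le_of_memH1Vec hd hk hV hA hθ hG
  set m := (volume {x | 0 < ‖V x‖}).toReal with hm
  set E := ∑ i, (eLpNorm (weakGrad fun x => V x i) 2 volume).toReal ^ 2 with hE
  have hE0 : 0 ≤ E := Finset.sum_nonneg fun i _ => sq_nonneg _
  have hm0 : 0 ≤ m := ENNReal.toReal_nonneg
  have hEV : dirichletEnergyVec V = ENNReal.ofReal E := by
    rw [hE, ENNReal.ofReal_sum_of_nonneg fun i _ => sq_nonneg _]
    refine Finset.sum_congr rfl fun i _ => ?_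
    rw [ENNReal.ofReal_pow ENNReal.toReal_nonneg,
      ENNReal.ofReal_toReal (hV i).weakGrad_spec.1.eLpNorm_ne_top, dirichletEnergy,
      lintegral_enorm_sq]
  have hfin : eigenvalueSum k Ω ≠ ⊤ := ne_top_of_le_ne_top ENNReal.ofReal_ne_top hle
  obtain ⟨s, hs0, hs⟩ : ∃ s : ℝ, 0 ≤ s ∧ eigenvalueSum k Ω = ENNReal.ofReal s :=
    ⟨_, ENNReal.toReal_nonneg, (ENNReal.ofReal_toReal hfin).symm⟩
  have hspos : 0 < s := by
    refine lt_of_le_of_ne hs0 fun h => hS0 ?_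
    rw [hs, ← h, ENNReal.ofReal_zero]
  have hsle : s ≤ m ^ (2 / d : ℝ) * (θ⁻¹ * E) :=
    (ENNReal.ofReal_le_ofReal_iff (by positivity)).1 (hs ▸ hle)
  have hmpos : 0 < m := by
    refine lt_of_le_of_ne hm0 fun h => ?_
    rw [← h, Real.zero_rpow (by positivity), zero_mul] at hsle
    linarith
  have hineq := one_add_le_rpow_neg_add hmpos (p := 2 / d) (by positivity)
  have h1 : s * m ^ (-(2 / d : ℝ)) ≤ θ⁻¹ * E := by
    rw [Real.rpow_neg hm0, ← div_eq_mul_inv, div_le_iff₀ (by positivity)]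
    linarith
  have hmE : volume {x | 0 < ‖V x‖} = ENNReal.ofReal m := (ENNReal.ofReal_toReal hA).symm
  rw [lagrangeMultiplier, hdE, hs, hEV, hmE, ← ENNReal.ofReal_mul (by positivity),
    ← ENNReal.ofReal_mul (by positivity), ← ENNReal.ofReal_mul (by positivity),
    ← ENNReal.ofReal_add hs0 (by positivity), ← ENNReal.ofReal_add (by positivity) (by positivity)]
  refine ENNReal.ofReal_le_ofReal ?_
  nlinarith [mul_le_mul_of_nonneg_left hineq hs0]

/-! ### Gram matrix of a perturbed orthonormal family -/

theorem toReal_eLpNorm_two_sq {α : Type*} [MeasurableSpace α] {μ : Measure α} {f : α → ℝ}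
    (hf : AEStronglyMeasurable f μ) : (eLpNorm f 2 μ).toReal ^ 2 = ∫ x, f x ^ 2 ∂μ := by
  rw [← ENNReal.toReal_pow, ← lintegral_enorm_sq,
    integral_eq_lintegral_of_nonneg_ae (Eventually.of_forall fun x => sq_nonneg _) (hf.pow 2)]
  congr 1
  refine lintegral_congr fun x => ?_
  rw [← sq_abs, ENNReal.ofReal_pow (abs_nonneg _), Real.enorm_eq_ofReal_abs]

theorem aestronglyMeasurable_of_apply {α : Type*} [MeasurableSpace α] {μ : Measure α} {k : ℕ}
    {U : α → Euc k} (h : ∀ i, AEStronglyMeasurable (fun x => U x i) μ) :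
    AEStronglyMeasurable U μ := by
  have h1 : AEMeasurable (fun x i => U x i) μ := aemeasurable_pi_lambda _ fun i => (h i).aemeasurable
  exact (PiLp.continuous_toLp 2 (fun _ : Fin k => ℝ)).comp_aestronglyMeasurable
    h1.aestronglyMeasurable

theorem memLp_two_of_apply {α : Type*} [MeasurableSpace α] {μ : Measure α} {k : ℕ}
    {U : α → Euc k} (h : ∀ i, MemLp (fun x => U x i) 2 μ) : MemLp U 2 μ := by
  have hU := aestronglyMeasurable_of_apply fun i => (h i).1
  rw [← memLp_norm_iff hU, memLp_two_iff_integrable_sq hU.norm]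
  simp only [EuclideanSpace.norm_sq_eq]
  exact integrable_finsetSum _ fun i _ => (h i).integrable_norm_pow two_ne_zero

theorem sq_sum_mul_le {k : ℕ} (c : Fin k → ℝ) (v : Euc k) :
    (∑ i, c i * v i) ^ 2 ≤ (∑ i, c i ^ 2) * ‖v‖ ^ 2 := by
  have := Finset.sum_mul_sq_le_sq_mul_sq Finset.univ c (fun i => v i)
  simpa [EuclideanSpace.norm_sq_eq] using this

/-- With a = c·u and b = c·v, a² - b² ≤ 2a(a - b), and Cauchy–Schwarz bounds the product. Only u has
to be bounded, so N will not depend on the competitor. -/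
theorem sum_sq_le_add_sq {k : ℕ} (c : Fin k → ℝ) (u v : Euc k) {N : ℝ} (hu : ‖u‖ ≤ N) :
    (∑ i, c i * u i) ^ 2 ≤
      (∑ i, c i * v i) ^ 2 + (∑ i, c i ^ 2) * (2 * N * ‖u - v‖) := by
  set C := ∑ i, c i ^ 2 with hC
  have hC0 : 0 ≤ C := Finset.sum_nonneg fun i _ => sq_nonneg _
  have e : ∑ i, c i * (u - v) i = ∑ i, c i * u i - ∑ i, c i * v i := by
    simp [mul_sub]
  have h1 := sq_sum_mul_le c u
  have h2 := sq_sum_mul_le c (u - v)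
  rw [e] at h2
  set a := ∑ i, c i * u i
  set b := ∑ i, c i * v i
  have h3 : a * (a - b) ≤ C * (N * ‖u - v‖) := by
    refine abs_le_of_sq_le_sq' ?_ (by have := (norm_nonneg u).trans hu; positivity) |>.2
    calc (a * (a - b)) ^ 2 = a ^ 2 * (a - b) ^ 2 := by ring
      _ ≤ (C * ‖u‖ ^ 2) * (C * ‖u - v‖ ^ 2) :=
          mul_le_mul h1 h2 (sq_nonneg _) (by positivity)
      _ ≤ (C * N ^ 2) * (C * ‖u - v‖ ^ 2) := by gcongr
      _ = _ := by ring
  nlinarith [sq_nonneg (a - b)]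

theorem integral_sq_sum_of_orthonormal {k : ℕ} {U : Euc d → Euc k}
    (hU : ∀ i, MemLp (fun x => U x i) 2 volume)
    (ho : ∀ i j : Fin k, ∫ x, U x i * U x j = if i = j then 1 else 0) (c : Fin k → ℝ) :
    ∫ x, (∑ i, c i * U x i) ^ 2 = ∑ i, c i ^ 2 := by
  have hint : ∀ i j, Integrable (fun x => c i * c j * (U x i * U x j)) volume := fun i j =>
    ((hU i).integrable_mul (hU j)).const_mul _
  have e : ∀ x, (∑ i, c i * U x i) ^ 2 = ∑ i, ∑ j, c i * c j * (U x i * U x j) := fun x => by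
    rw [sq, Finset.sum_mul_sum]
    exact Finset.sum_congr rfl fun i _ => Finset.sum_congr rfl fun j _ => by ring
  simp only [e]
  rw [integral_finsetSum _ fun i _ => integrable_finsetSum _ fun j _ => hint i j]
  refine Finset.sum_congr rfl fun i _ => ?_
  rw [integral_finsetSum _ fun j _ => hint i j]
  simp [integral_const_mul, ho, sq]

/-- A lower bound for the Gram matrix of a perturbation of an orthonormal family. -/
theorem gram_lower_bound {k : ℕ} {U V : Euc d → Euc k}
    (hU : ∀ i, MemLp (fun x => U x i) 2 volume) (hV : ∀ i, MemLp (fun x => V x i) 2 volume)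
    (ho : ∀ i j : Fin k, ∫ x, U x i * U x j = if i = j then 1 else 0)
    (hUV : Integrable (U - V) volume) {N : ℝ} (hN : 0 ≤ N) (c : Fin k → ℝ) :
    (1 - 2 * N * (∫ x, ‖U x - V x‖) -
        ∫ x, {x | N < ‖U x‖}.indicator (fun x => ‖U x‖ ^ 2) x) * ∑ i, c i ^ 2 ≤
      (eLpNorm (fun x => ∑ i, c i * V x i) 2 volume).toReal ^ 2 := by
  set C := ∑ i, c i ^ 2 with hC
  have hC0 : 0 ≤ C := Finset.sum_nonneg fun i _ => sq_nonneg _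
  have hcU : MemLp (fun x => ∑ i, c i * U x i) 2 volume :=
    memLp_finsetSum _ fun i _ => (hU i).const_mul _
  have hcV : MemLp (fun x => ∑ i, c i * V x i) 2 volume :=
    memLp_finsetSum _ fun i _ => (hV i).const_mul _
  have hU2 := memLp_two_of_apply hU
  have hms : NullMeasurableSet {x | N < ‖U x‖} volume :=
    nullMeasurableSet_lt aemeasurable_const hU2.1.norm.aemeasurable
  have i1 : Integrable (fun x => ({x | N < ‖U x‖}.indicator (fun x => ‖U x‖ ^ 2) x)) volume :=
    (hU2.integrable_norm_pow two_ne_zero).indicator₀ hms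
  have i2 : Integrable (fun x => 2 * N * ‖U x - V x‖) volume := hUV.norm.const_mul _
  have i3 : Integrable (fun x => (∑ i, c i * V x i) ^ 2) volume := hcV.integrable_sq
  have i4 : Integrable (fun x => C * (2 * N * ‖U x - V x‖ +
      {x | N < ‖U x‖}.indicator (fun x => ‖U x‖ ^ 2) x)) volume := (i2.add i1).const_mul _
  have hle : ∫ x, (∑ i, c i * U x i) ^ 2 ≤ ∫ x, ((∑ i, c i * V x i) ^ 2 +
      C * (2 * N * ‖U x - V x‖ + {x | N < ‖U x‖}.indicator (fun x => ‖U x‖ ^ 2) x)) := by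
    refine integral_mono hcU.integrable_sq (i3.add i4) fun x => ?_
    simp only []
    -- Where |U| > N, the crude bound (c·U)² ≤ |c|²|U|² is absorbed by the tail term; elsewhere
    -- `sum_sq_le_add_sq` applies.
    by_cases hx : N < ‖U x‖
    · rw [Set.indicator_of_mem (by exact hx)]
      have h1 := sq_sum_mul_le c (U x)
      have h2 : 0 ≤ C * (2 * N * ‖U x - V x‖) := by positivity
      nlinarith [sq_nonneg (∑ i, c i * V x i)]
    · have := sum_sq_le_add_sq c (U x) (V x) (not_lt.1 hx)
      rw [Set.indicator_of_notMem (by exact hx), add_zero]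
      exact this
  rw [integral_sq_sum_of_orthonormal hU ho, integral_add i3 i4, integral_const_mul,
    integral_add i2 i1, integral_const_mul] at hle
  rw [toReal_eLpNorm_two_sq hcV.1]
  linarith

theorem exists_integral_indicator_norm_sq_le {α E : Type*} [MeasurableSpace α] {μ : Measure α}
    [NormedAddCommGroup E] {U : α → E} (hU : MemLp U 2 μ) {η : ℝ} (hη : 0 < η) :
    ∃ N : ℝ, 0 < N ∧ ∫ x, {x | N < ‖U x‖}.indicator (fun x => ‖U x‖ ^ 2) x ∂μ ≤ η := by
  have hlim : Tendsto (fun n : ℕ => ∫ x, {x | (n : ℝ) < ‖U x‖}.indicator (fun x => ‖U x‖ ^ 2) x ∂μ)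
      atTop (𝓝 (∫ _, 0 ∂μ)) := by
    refine tendsto_integral_of_dominated_convergence (fun x => ‖U x‖ ^ 2) (fun n => ?_)
      (hU.integrable_norm_pow two_ne_zero) (fun n => ?_) ?_
    · exact ((hU.integrable_norm_pow two_ne_zero).indicator₀
        (nullMeasurableSet_lt aemeasurable_const hU.1.norm.aemeasurable)).1
    · refine Eventually.of_forall fun x => (norm_indicator_le_norm_self _ _).trans ?_
      simp
    · refine Eventually.of_forall fun x => ?_
      obtain ⟨n, hn⟩ := exists_nat_ge ‖U x‖
      refine tendsto_const_nhds.congr' ?_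
      filter_upwards [eventually_ge_atTop n] with m hm
      rw [Set.indicator_of_notMem]
      exact not_lt.2 (hn.trans (by exact_mod_cast hm))
  simp only [integral_zero] at hlim
  obtain ⟨n, hn, hn0⟩ := ((hlim.eventually_le_const hη).and (eventually_gt_atTop 0)).exists
  exact ⟨n, by exact_mod_cast hn0, hn⟩

/-- Where |U| > 2M and |V| ≤ M, |U - V| ≥ M; then Chebyshev. -/
theorem mul_measure_le_eLpNorm_sub {α E : Type*} [MeasurableSpace α] {μ : Measure α}
    [NormedAddCommGroup E] {U V : α → E} (hU : AEStronglyMeasurable U μ)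
    (hV : AEStronglyMeasurable V μ) {M : ℝ} (hM : 0 < M)
    (hVM : eLpNorm V ⊤ μ ≤ ENNReal.ofReal M) :
    ENNReal.ofReal M * μ {x | 2 * M < ‖U x‖} ≤ eLpNorm (U - V) 1 μ := by
  have h1 : ∀ᵐ x ∂μ, ‖V x‖ₑ ≤ ENNReal.ofReal M := by
    rw [eLpNorm_exponent_top] at hVM
    filter_upwards [ae_le_eLpNormEssSup (f := V) (μ := μ)] with x hx
    exact hx.trans hVM
  have h2 : μ {x | 2 * M < ‖U x‖} ≤ μ {x | ENNReal.ofReal M ≤ ‖(U - V) x‖ₑ} := by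
    refine measure_mono_ae ?_
    filter_upwards [h1] with x hx hUx
    have hUx : 2 * M < ‖U x‖ := hUx
    have hVx : ‖V x‖ ≤ M := by
      rwa [← ofReal_norm, ENNReal.ofReal_le_ofReal_iff hM.le] at hx
    change ENNReal.ofReal M ≤ ‖(U - V) x‖ₑ
    rw [← ofReal_norm]
    refine ENNReal.ofReal_le_ofReal ?_
    have := norm_sub_norm_le (U x) (V x)
    rw [Pi.sub_apply]
    linarith
  have h3 := mul_meas_ge_le_pow_eLpNorm' μ one_ne_zero ENNReal.one_ne_top (hU.sub hV)
    (ENNReal.ofReal M)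
  simp only [ENNReal.toReal_one, ENNReal.rpow_one] at h3
  exact (mul_le_mul_right h2 _).trans h3

/-- The constants of the quasi-minimality inequality. If `U` is essentially bounded the defect of
the Gram matrix is linear in the `L¹` distance; otherwise bounded competitors stay at a positive
`L¹` distance from `U`. -/
theorem exists_gram_constants {α E : Type*} [MeasurableSpace α] {μ : Measure α}
    [NormedAddCommGroup E] {U : α → E} (hU : MemLp U 2 μ) :
    ∃ N : ℝ, 0 < N ∧ ∃ K : ℝ, 0 < K ∧ ∃ ε : ℝ, 0 < ε ∧ ∀ V : α → E, AEStronglyMeasurable V μ →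
      eLpNorm V ⊤ μ ≤ ENNReal.ofReal ε⁻¹ → ∀ δ : ℝ, 0 ≤ δ → δ ≤ ε →
      eLpNorm (U - V) 1 μ = ENNReal.ofReal δ →
      ∃ θ : ℝ, 0 < θ ∧ θ⁻¹ ≤ 1 + K * δ ∧
        θ ≤ 1 - 2 * N * δ - ∫ x, {x | N < ‖U x‖}.indicator (fun x => ‖U x‖ ^ 2) x ∂μ := by
  by_cases hb : ∃ N : ℝ, 0 < N ∧ ∀ᵐ x ∂μ, ‖U x‖ ≤ N
  · obtain ⟨N, hN, hUN⟩ := hb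
    have h0 : ∫ x, {x | N < ‖U x‖}.indicator (fun x => ‖U x‖ ^ 2) x ∂μ = 0 := by
      refine integral_eq_zero_of_ae ?_
      filter_upwards [hUN] with x hx
      rw [Set.indicator_of_notMem (by exact not_lt.2 hx)]
      rfl
    -- With t = 2Nδ ≤ 1/2, (1 - t)(1 + 2t) ≥ 1, hence K = 4N.
    refine ⟨N, hN, 4 * N, by positivity, 1 / (4 * N), by positivity, fun V _ _ δ hδ0 hδ _ =>
      ⟨1 - 2 * N * δ, ?_, ?_, by rw [h0, sub_zero]⟩⟩
    all_goals
      rw [le_div_iff₀ (by positivity)] at hδ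
    · linarith
    · have h2 : 0 ≤ N * δ := by positivity
      rw [inv_le_iff_one_le_mul₀ (by linarith)]
      nlinarith
  -- The tail and 2Nδ each cost at most 1/4, so θ = 1/2 is allowed. Competitors are bounded by M =
  -- 8N, and U exceeds 2M on a set of positive measure, which forces δ ≥ c > 0 and 2 ≤ 1 + δ/c.
  · obtain ⟨N, hN, hη⟩ := exists_integral_indicator_norm_sq_le hU (η := 1 / 4) (by norm_num)
    have hM : 0 < (1 / (8 * N))⁻¹ := by positivity
    have hpos : 0 < ENNReal.ofReal (1 / (8 * N))⁻¹ * μ {x | 2 * (1 / (8 * N))⁻¹ < ‖U x‖} := by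
      refine ENNReal.mul_pos (ENNReal.ofReal_pos.2 hM).ne' fun h => hb ⟨_, mul_pos two_pos hM, ?_⟩
      rw [ae_iff]
      simpa only [not_le] using h
    obtain ⟨c, hc0, hc⟩ := ENNReal.lt_iff_exists_real_btwn.1 hpos
    have hc1 : 0 < c := ENNReal.ofReal_pos.1 hc.1
    refine ⟨N, hN, 1 / c, by positivity, 1 / (8 * N), by positivity,
      fun V hVm hV δ hδ0 hδ hUV => ⟨1 / 2, by norm_num, ?_, ?_⟩⟩
    · have h1 := hc.2.le.trans (mul_measure_le_eLpNorm_sub hU.1 hVm hM hV)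
      rw [hUV, ENNReal.ofReal_le_ofReal_iff hδ0] at h1
      have : 1 ≤ 1 / c * δ := by rw [one_div, inv_mul_eq_div, le_div_iff₀ hc1]; linarith
      norm_num
      simpa using (by linarith : (2 : ℝ) ≤ 1 + 1 / c * δ)
    · rw [le_div_iff₀ (by positivity)] at hδ
      linarith

end

theorem mainTheorem3 (d k : ℕ) (hd : 1 ≤ d) (hk : 1 ≤ k) (Ω : Set (Euc d))
    (hΩ : IsOptimalSet k Ω) (U : Euc d → Euc k) (hU : IsEigenfunctionVector Ω U) :
    ∃ K : ℝ, 0 < K ∧ ∃ ε : ℝ, 0 < ε ∧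
      ∀ V : Euc d → Euc k, MemH1Vec V →
        eLpNorm V ∞ volume ≤ ENNReal.ofReal ε⁻¹ →
        eLpNorm (U - V) 1 volume ≤ ENNReal.ofReal ε →
        dirichletEnergyVec U + lagrangeMultiplier k Ω * volume {x | 0 < ‖U x‖} ≤
          (1 + ENNReal.ofReal K * eLpNorm (U - V) 1 volume) * dirichletEnergyVec V +
            lagrangeMultiplier k Ω * volume {x | 0 < ‖V x‖} := by
  have hUH : MemH10Vec Ω U := fun i => (hU.1 i).1
  have hUL := memLp_two_of_apply fun i => (hUH i).1
  obtain ⟨N, hN, K, hK, ε, hε, H⟩ := exists_gram_constants hUL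
  refine ⟨K, hK, ε, hε, fun V hV hVb hUV => ?_⟩
  have hVL := memLp_two_of_apply fun i => (hV i).1
  have hi : Integrable (U - V) volume :=
    memLp_one_iff_integrable.1 ⟨hUL.1.sub hVL.1, hUV.trans_lt ENNReal.ofReal_lt_top⟩
  set δ : ℝ := ∫ x, ‖U x - V x‖ with hδ
  have hδ0 : 0 ≤ δ := integral_nonneg fun x => norm_nonneg _
  have hδe : eLpNorm (U - V) 1 volume = ENNReal.ofReal δ := by
    rw [eLpNorm_one_eq_lintegral_enorm, hδ]
    exact (ofReal_integral_norm_eq_lintegral_enorm hi).symm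
  have hδε : δ ≤ ε := by rwa [hδe, ENNReal.ofReal_le_ofReal_iff hε.le] at hUV
  obtain ⟨θ, hθ, hθK, hθN⟩ := H V hVL.1 hVb δ hδ0 hδε hδe
  have hmain := hΩ.add_le_of_memH1Vec hd hk hV hθ fun c =>
    (mul_le_mul_of_nonneg_right hθN (Finset.sum_nonneg fun i _ => sq_nonneg (c i))).trans
      (gram_lower_bound (fun i => (hUH i).1) (fun i => (hV i).1) hU.2 hi hN.le c)
  have hvol : volume {x | 0 < ‖U x‖} ≤ 1 :=
    (hUH.volume_norm_pos_le hΩ.1.measurableSet).trans hΩ.2.1.le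
  -- The functional at U is at most S + Λ, since U vanishes a.e. outside Ω and |Ω| = 1.
  refine (add_le_add hU.dirichletEnergyVec_le (mul_le_of_le_one_right' hvol)).trans
    (hmain.trans ?_)
  gcongr
  rw [hδe, ← ENNReal.ofReal_mul hK.le, ← ENNReal.ofReal_one,
    ← ENNReal.ofReal_add zero_le_one (by positivity)]
  exact ENNReal.ofReal_le_ofReal hθK
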